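/- Let $n\ge 1$ and let $\mathrm{QC}(\mathbb R^n)$ be the class of upper semicontinuous functions $f:\mathbb R^n\to[0,\infty)$ that are quasi-concave, i.e. $f(\lambda x+(1-\lambda)y)\ge\min\{f(x),f(y)\}$ for all $x,y\in\mathbb R^n$, $0<\lambda<1$. Put $(f\oplus g)(x)=\sup_{y}\min\{f(y),g(x-y)\}\in[0,\infty]$, $(\lambda\odot f)(x)=f(x/\lambda)$ for $\lambda>0$, and $\overline K_t(f)=\{x: f(x)\ge t\}$ for $t>0$. For non-empty compact convex sets $L_1,\dots,L_n\subset\mathbb R^n$ let $V(L_1,\dots,L_n)=\frac1{n!}\sum_{S\subseteq\{1,\dots,n\}}(-1)^{n-|S|}\,\mathrm{Vol}\big(\sum_{i\in S}L_i\big)$ be their mixed volume; for closed convex sets $K_1,\dots,K_n\subseteq\mathbb R^n$ let $V(K_1,\dots,K_n)\in[0,\infty]$ be the supremum of $V(L_1,\dots,L_n)$ over all non-empty compact convex $L_i\subseteq K_i$ (so $V=0$ if some $K_i$ is empty). Let $m\ge1$, $f_1,\dots,f_m\in\mathrm{QC}(\mathbb R^n)$ and $T=\min_{j}\sup f_j\in[0,\infty]$.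 Then the function $F:(0,\infty)^m\to[0,\infty]$, $$F(\varepsilon_1,\dots,\varepsilon_m)=\int_{\mathbb R^n}(\varepsilon_1\odot f_1)\oplus\cdots\oplus(\varepsilon_m\odot f_m),$$ is a homogeneous polynomial of degree $n$ with non-negative (possibly infinite) coefficients: $$F(\varepsilon_1,\dots,\varepsilon_m)=\sum_{i_1,\dots,i_n=1}^m\varepsilon_{i_1}\cdots\varepsilon_{i_n}\,c(i_1,\dots,i_n),\qquad c(i_1,\dots,i_n)=\int_0^{T}V\big(\overline K_t(f_{i_1}),\dots,\overline K_t(f_{i_n})\big)\,dt,$$ where $c$ is symmetric. If $F$ is finite at some point, then $c$ is the only symmetric function of $(i_1,\dots,i_n)$ with values in $[0,\infty]$ for which this expansion holds on $(0,\infty)^m$. If the indices $i_1,\dots,i_n$ include every element of $\{1,\dots,m\}$, or more generally include some $j$ for which $\sup f_j=T$ (as they always do when all the $f_j$ have the same supremum), then $c(i_1,\dots,i_n)$ is the mixed integral $$V(f_{i_1},\dots,f_{i_n})=\int_0^\infty V\big(\overline K_t(f_{i_1}),\dots,\overline K_t(f_{i_n})\big)\,dt .$$ In particular, for $m=n$ one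 has $c(1,\dots,n)=\int_0^\infty V(\overline K_t(f_1),\dots,\overline K_t(f_n))\,dt$. -/

import Mathlib

open MeasureTheory
open scoped ENNReal Pointwise Nat

noncomputable section

namespace QuasiConcave

/-- The class `QC(ℝⁿ)`: upper semicontinuous quasi-concave functions `ℝⁿ → [0, ∞)`. -/
structure IsQC {n : ℕ} (f : EuclideanSpace ℝ (Fin n) → ℝ) : Prop where
  nonneg : ∀ x, 0 ≤ f x
  upperSemicontinuous : UpperSemicontinuous f
  quasiconcave : QuasiconcaveOn ℝ Set.univ f

/-- A function with values in `[0, ∞)` viewed with values in `[0, ∞]`, since the supremum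
defining `⊕` may be infinite. -/
def toENN {n : ℕ} (f : EuclideanSpace ℝ (Fin n) → ℝ) (x : EuclideanSpace ℝ (Fin n)) : ℝ≥0∞ :=
  ENNReal.ofReal (f x)

/-- `(f ⊕ g)(x) = sup_y min {f(y), g(x - y)}`. -/
def oplus {n : ℕ} (f g : EuclideanSpace ℝ (Fin n) → ℝ≥0∞) (x : EuclideanSpace ℝ (Fin n)) : ℝ≥0∞ :=
  ⨆ y, min (f y) (g (x - y))

/-- `(a ⊙ f)(x) = f(x / a)`, used for `a > 0` only. -/
def odot {n : ℕ} (a : ℝ) (f : EuclideanSpace ℝ (Fin n) → ℝ≥0∞) (x : EuclideanSpace ℝ (Fin n)) :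
    ℝ≥0∞ :=
  f (a⁻¹ • x)

/-- The iterated sum `g 0 ⊕ g 1 ⊕ ⋯ ⊕ g m` of `m + 1` functions, bracketed from the left. -/
def oplusSum {n : ℕ} : (m : ℕ) → (Fin (m + 1) → EuclideanSpace ℝ (Fin n) → ℝ≥0∞) →
    EuclideanSpace ℝ (Fin n) → ℝ≥0∞
  | 0, g => g 0
  | m + 1, g => oplus (oplusSum m fun i => g i.castSucc) (g (Fin.last (m + 1)))

/-- `F(ε) = ∫ (ε 0 ⊙ f 0) ⊕ ⋯ ⊕ (ε m ⊙ f m)`, with value in `[0, ∞]`. -/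
def sumIntegral {n m : ℕ} (f : Fin (m + 1) → EuclideanSpace ℝ (Fin n) → ℝ)
    (ε : Fin (m + 1) → ℝ) : ℝ≥0∞ :=
  ∫⁻ x, oplusSum m (fun i => odot (ε i) (toENN (f i))) x

/-- The upper level set `{x | f x ≥ t}`. -/
def levelSet {n : ℕ} (f : EuclideanSpace ℝ (Fin n) → ℝ) (t : ℝ) :
    Set (EuclideanSpace ℝ (Fin n)) :=
  {x | t ≤ f x}

/-- The mixed volume of `n` convex bodies (non-empty compact convex sets) in `ℝⁿ`: the symmetric
polarization `(1 / n!) ∑_S (-1)^(n - |S|) Vol(∑_{i ∈ S} L i)` of the volume. -/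
def bodyMixedVolume {n : ℕ} (L : Fin n → ConvexBody (EuclideanSpace ℝ (Fin n))) : ℝ :=
  (n ! : ℝ)⁻¹ * ∑ S : Finset (Fin n),
    (-1 : ℝ) ^ (n - S.card) *
      (volume ((∑ i ∈ S, L i : ConvexBody (EuclideanSpace ℝ (Fin n))) :
        Set (EuclideanSpace ℝ (Fin n)))).toReal

/-- The mixed volume, in `[0, ∞]`, of `n` closed convex sets in `ℝⁿ`, not necessarily compact: the
supremum of the mixed volumes of convex bodies contained in them. It is `0` if one of the sets is
empty, since the supremum is then over an empty family. -/
def mixedVolume {n : ℕ} (K : Fin n → Set (EuclideanSpace ℝ (Fin n))) : ℝ≥0∞ :=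
  ⨆ (L : Fin n → ConvexBody (EuclideanSpace ℝ (Fin n)))
    (_ : ∀ i, (L i : Set (EuclideanSpace ℝ (Fin n))) ⊆ K i),
    ENNReal.ofReal (bodyMixedVolume L)

/-- The mixed integral `∫_0^∞ V(K_t(g 1), …, K_t(g n)) dt` of `n` functions on `ℝⁿ`. -/
def mixedIntegral {n : ℕ} (g : Fin n → EuclideanSpace ℝ (Fin n) → ℝ) : ℝ≥0∞ :=
  ∫⁻ t in Set.Ioi (0 : ℝ), mixedVolume fun k => levelSet (g k) t

/-- The supremum of a function, in `[0, ∞]`. -/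
def height {n : ℕ} (f : EuclideanSpace ℝ (Fin n) → ℝ) : ℝ≥0∞ :=
  ⨆ x, toENN f x

/-- The mixed integral of `n` functions, cut off at height `T`:
`∫_0^T V(K_t(g 1), …, K_t(g n)) dt`. -/
def mixedIntegralUpTo {n : ℕ} (T : ℝ≥0∞) (g : Fin n → EuclideanSpace ℝ (Fin n) → ℝ) : ℝ≥0∞ :=
  ∫⁻ t in {t : ℝ | 0 < t ∧ ENNReal.ofReal t < T}, mixedVolume fun k => levelSet (g k) t

/-- `F` is, for positive arguments, the homogeneous polynomial of degree `n` with coefficients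
`c` in `[0, ∞]`: `F(ε) = ∑_{i_1, …, i_n} ε_{i_1} ⋯ ε_{i_n} c(i_1, …, i_n)`, where `c` is
symmetric. -/
def IsSymmExpansion {m n : ℕ} (F : (Fin m → ℝ) → ℝ≥0∞) (c : (Fin n → Fin m) → ℝ≥0∞) : Prop :=
  (∀ (σ : Equiv.Perm (Fin n)) (I : Fin n → Fin m), c (I ∘ σ) = c I) ∧
    ∀ ε : Fin m → ℝ, (∀ i, 0 < ε i) →
      F ε = ∑ I : Fin n → Fin m, ENNReal.ofReal (∏ k, ε (I k)) * c I

end QuasiConcave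

end

/-!
The open level sets of the sum are Minkowski combinations: `{(ε 0 ⊙ f 0) ⊕ ⋯ ⊕ (ε m ⊙ f m) > t}` is
`∑ ε i • {f i > t}`. By the layer cake formula it is therefore enough to show that the volume of
`∑ ε i • A i` is a polynomial in `ε` with the mixed volumes as coefficients, for all non-empty
convex sets `A i`, and to replace open by closed level sets afterwards: by monotonicity in `t` the
two give the same mixed volume except at countably many heights. Heights above `T` contribute
nothing, since one of the level sets is then empty.

For polytopes, the Cayley trick presents `∑ ε i • A i` as the section at `ε` of one fixed polyhedral
cone. Generic heights on the generators subdivide the cone into simplicial cones, and a diagonal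
linear map takes the section at `1` of a simplicial cone to its section at `ε`, with a monomial of
degree `n` in `ε` as Jacobian. Since a subdivision extends to one for a larger set of generators,
the coefficients, and hence the mixed volumes, grow with the polytopes. Polytopes exhaust a convex
set, so the expansion survives the supremum over polytopes.

Finally, a polarization identity recovers symmetric coefficients from the polynomial.
-/

noncomputable section

namespace QuasiConcave

open Filter Topology

section Cone

variable {E W : Type*} [AddCommGroup W] [Module ℝ W] {a : E → W} {w : E → ℝ} {z : W}
  {B B' D S : Finset E}

/-- The indices in `B` pick out a basis among the vectors `a e`. -/
structure IsBasisSet (a : E → W) (B : Finset E) : Prop where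
  linearIndepOn : LinearIndepOn ℝ a (B : Set E)
  span_eq_top : Submodule.span ℝ (a '' (B : Set E)) = ⊤

/-- The point `z` lies on no proper subspace spanned by some of the vectors `a e`. -/
def InGeneralPosition (a : E → W) (z : W) : Prop :=
  ∀ S : Finset E, z ∈ Submodule.span ℝ (a '' (S : Set E)) →
    Submodule.span ℝ (a '' (S : Set E)) = ⊤

/-- The heights `w` are generic: a hyperplane through lifted basis vectors `(a e, w e)` contains
no other lifted vector. -/
def IsGeneric (a : E → W) (w : E → ℝ) : Prop :=
  ∀ B, IsBasisSet a B → ∀ y : W →ₗ[ℝ] ℝ, (∀ e ∈ B, y (a e) = w e) → ∀ j ∉ B, y (a j) ≠ w j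

/-- `B` spans a simplicial cell of the regular subdivision, induced by the heights `w`, of the cone
over `D`: some hyperplane passes through the lifted vectors of `B` and strictly below all the other
lifted vectors of `D`. -/
structure IsCell (a : E → W) (w : E → ℝ) (D B : Finset E) : Prop where
  subset : B ⊆ D
  isBasisSet : IsBasisSet a B
  exists_supporting : ∃ y : W →ₗ[ℝ] ℝ, (∀ e ∈ B, y (a e) = w e) ∧ ∀ e ∈ D, e ∉ B → y (a e) < w e

/-- The basis picked out by `B`. -/
def IsBasisSet.basis (hB : IsBasisSet a B) : Module.Basis B ℝ W :=
  .mk hB.linearIndepOn (by rw [← Set.image_eq_range, ← hB.span_eq_top])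

@[simp]
theorem IsBasisSet.basis_apply (hB : IsBasisSet a B) (e : B) : hB.basis e = a e := by
  simp [IsBasisSet.basis]

theorem IsBasisSet.subset_of_span_eq_top (hB : IsBasisSet a B) (hSB : S ⊆ B)
    (hS : Submodule.span ℝ (a '' (S : Set E)) = ⊤) : B ⊆ S := by
  intro j hj
  have hli := hB.linearIndepOn.mono (Finset.coe_subset.2 hSB)
  exact hli.mem_span_iff.1 (hS ▸ Submodule.mem_top)
    (hB.linearIndepOn.mono (Set.insert_subset hj (Finset.coe_subset.2 hSB)))

theorem exists_isBasisSet_subset (hS : Submodule.span ℝ (a '' (S : Set E)) = ⊤) :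
    ∃ B ⊆ S, IsBasisSet a B := by
  obtain ⟨B, hBS, -, hspan, hli⟩ := exists_linearIndepOn_extension (linearIndepOn_empty ℝ a)
    (Set.empty_subset (S : Set E))
  lift B to Finset E using S.finite_toSet.subset hBS
  exact ⟨B, by exact_mod_cast hBS, hli, top_le_iff.1 (hS ▸ Submodule.span_le.2 hspan)⟩

variable [Fintype E] {l l' : E → ℝ}

/-- The non-negative weights supported in `D` that represent `z` as a combination of the vectors
`a e`. -/
def weights (a : E → W) (D : Finset E) (z : W) : Set (E → ℝ) :=
  {l | (∀ e, 0 ≤ l e) ∧ (∀ e ∉ D, l e = 0) ∧ ∑ e, l e • a e = z}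

/-- The convex cone generated by the vectors `a e`, `e ∈ D`. -/
def conicHull (a : E → W) (D : Finset E) : Set W :=
  {z | (weights a D z).Nonempty}

theorem weights_mono (h : B ⊆ D) : weights a B z ⊆ weights a D z :=
  fun _ ⟨h0, hB, hz⟩ => ⟨h0, fun e he => hB e fun h' => he (h h'), hz⟩

theorem conicHull_mono (h : B ⊆ D) : conicHull a B ⊆ conicHull a D :=
  fun _ hz => hz.mono (weights_mono h)

theorem mem_conicHull_of_mem {e : E} (he : e ∈ D) : a e ∈ conicHull a D := by
  classical
  have h0 : (0 : E → ℝ) ≤ Pi.single e 1 := Pi.single_nonneg.2 zero_le_one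
  refine ⟨Pi.single e 1, h0, fun e' he' => ?_, ?_⟩
  · exact Pi.single_eq_of_ne (ne_of_mem_of_not_mem he he').symm 1
  · simp [Pi.single_apply]

theorem sum_smul_mem_conicHull {κ : Type*} {s : Finset κ} {c : κ → ℝ} {v : κ → W}
    (hc : ∀ i ∈ s, 0 ≤ c i) (hv : ∀ i ∈ s, v i ∈ conicHull a D) :
    ∑ i ∈ s, c i • v i ∈ conicHull a D := by
  choose! l hl0 hlD hlv using hv
  refine ⟨∑ i ∈ s, c i • l i, fun e => ?_, fun e he => ?_, ?_⟩
  · simpa using Finset.sum_nonneg fun i hi => mul_nonneg (hc i hi) (hl0 i hi e)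
  · simpa using Finset.sum_eq_zero fun i hi => by rw [hlD i hi e he, mul_zero]
  · simp only [Finset.sum_apply, Pi.smul_apply, smul_eq_mul, Finset.sum_smul, mul_smul]
    rw [Finset.sum_comm]
    exact Finset.sum_congr rfl fun i hi => by rw [← Finset.smul_sum, hlv i hi]

theorem convex_conicHull (a : E → W) (D : Finset E) : Convex ℝ (conicHull a D) :=
  convex_iff_sum_mem.2 fun _ _ hc _ hv => sum_smul_mem_conicHull hc hv

theorem isClosed_weights [TopologicalSpace W] [T1Space W] [ContinuousAdd W] [ContinuousSMul ℝ W]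
    (a : E → W) (D : Finset E) (z : W) : IsClosed (weights a D z) := by
  have hsum : IsClosed {l : E → ℝ | ∑ e, l e • a e = z} :=
    isClosed_singleton.preimage (f := fun l : E → ℝ => ∑ e, l e • a e) (by fun_prop)
  have hsupp : IsClosed {l : E → ℝ | ∀ e ∉ D, l e = 0} := by
    simp only [Set.ofPred_forall]
    exact isClosed_iInter fun e => isClosed_iInter fun _ =>
      isClosed_eq (continuous_apply e) continuous_const
  exact isClosed_Ici.inter (hsupp.inter hsum)

theorem sum_smul_mem_span (a : E → W) (hl : ∀ e ∉ S, l e = 0) :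
    ∑ e, l e • a e ∈ Submodule.span ℝ (a '' (S : Set E)) := by
  refine Submodule.sum_mem _ fun e _ => ?_
  by_cases he : e ∈ S
  · exact Submodule.smul_mem _ _ (Submodule.subset_span ⟨e, he, rfl⟩)
  · simp [hl e he]

theorem sum_mul_eq_add_sum_mul_sub (y : W →ₗ[ℝ] ℝ) (w : E → ℝ) (hz : ∑ e, l e • a e = z) :
    ∑ e, l e * w e = y z + ∑ e, l e * (w e - y (a e)) := by
  simp [← hz, mul_sub]

theorem IsBasisSet.exists_sum_smul_eq (hB : IsBasisSet a B) (v : W) :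
    ∃ β : E → ℝ, (∀ e ∉ B, β e = 0) ∧ ∑ e, β e • a e = v := by
  obtain ⟨β, hβB, hβ⟩ := (Finsupp.mem_span_image_iff_linearCombination ℝ).1
    (hB.span_eq_top ▸ Submodule.mem_top : v ∈ Submodule.span ℝ (a '' (B : Set E)))
  refine ⟨β, fun e he => by simpa using fun h => he (hβB h), ?_⟩
  rw [← hβ, Finsupp.linearCombination_apply, Finsupp.sum_fintype _ _ (by simp)]

theorem IsBasisSet.exists_exchange (hB : IsBasisSet a B) {j : E} (hj : j ∉ B) :
    ∃ d : E → ℝ, d j = 1 ∧ (∀ e ∉ B, e ≠ j → d e = 0) ∧ ∑ e, d e • a e = 0 := by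
  classical
  obtain ⟨β, hβB, hβ⟩ := hB.exists_sum_smul_eq (a j)
  exact ⟨fun e => (if e = j then 1 else 0) - β e, by simp [hβB j hj],
    fun e he hej => by simp [hβB e he, hej], by simp [sub_smul, hβ]⟩

theorem cost_nonneg_of_isMinOn {d : E → ℝ} (hl : l ∈ weights a D z)
    (hmin : IsMinOn (fun l => ∑ e, l e * w e) (weights a D z) l)
    (hdD : ∀ e ∉ D, d e = 0) (hd : ∑ e, d e • a e = 0) (hneg : ∀ e, d e < 0 → 0 < l e) :
    0 ≤ ∑ e, d e * w e := by
  have hfeasible : ∀ᶠ s in 𝓝[>] (0 : ℝ), ∀ e, 0 ≤ l e + s * d e := by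
    refine eventually_all.2 fun e => ?_
    rcases lt_or_ge (d e) 0 with h | h
    · have hcont : ContinuousAt (fun s : ℝ => l e + s * d e) 0 := by fun_prop
      have := hcont.eventually (lt_mem_nhds (a := 0) (by simpa using hneg e h))
      exact nhdsWithin_le_nhds (this.mono fun s hs => hs.le)
    · filter_upwards [eventually_mem_nhdsWithin] with s hs
      exact add_nonneg (hl.1 e) (mul_nonneg (le_of_lt hs) h)
  obtain ⟨s, hpos, hs : 0 < s⟩ := (hfeasible.and eventually_mem_nhdsWithin).exists
  have hmem : (fun e => l e + s * d e) ∈ weights a D z := by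
    refine ⟨hpos, fun e he => by simp [hl.2.1 e he, hdD e he], ?_⟩
    simp [add_smul, mul_smul, Finset.sum_add_distrib, ← Finset.smul_sum, hd, hl.2.2]
  have hle : ∑ e, l e * w e ≤ ∑ e, (l e + s * d e) * w e := hmin hmem
  simp only [add_mul, Finset.sum_add_distrib, mul_assoc, ← Finset.mul_sum] at hle
  exact nonneg_of_mul_nonneg_right (by linarith) hs

theorem complementary_slackness_of_isMinOn (hl : l ∈ weights a D z)
    (hmin : IsMinOn (fun l => ∑ e, l e * w e) (weights a D z) l) (hB : IsBasisSet a B)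
    (hpos : ∀ e ∈ B, 0 < l e) {y : W →ₗ[ℝ] ℝ} (hy : ∀ e ∈ B, y (a e) = w e) {j : E}
    (hjD : j ∈ D) : y (a j) ≤ w j ∧ (l j ≠ 0 → y (a j) = w j) := by
  by_cases hj : j ∈ B
  · simp [hy j hj]
  have hBD : B ⊆ D := fun e he => by_contra fun h => (hpos e he).ne' (hl.2.1 e h)
  obtain ⟨d, hdj, hd0, hd⟩ := hB.exists_exchange hj
  have hcost : ∑ e, d e * w e = w j - y (a j) := by
    rw [sum_mul_eq_add_sum_mul_sub y w hd, map_zero, zero_add,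
      Finset.sum_eq_single_of_mem j (Finset.mem_univ j), hdj, one_mul]
    intro e _ hej
    by_cases he : e ∈ B
    · simp [hy e he]
    · simp [hd0 e he hej]
  have hdD : ∀ e ∉ D, d e = 0 := fun e he =>
    hd0 e (fun h => he (hBD h)) fun h => he (h ▸ hjD)
  have hle : y (a j) ≤ w j := by
    rw [← sub_nonneg, ← hcost]
    refine cost_nonneg_of_isMinOn hl hmin hdD hd fun e he => hpos e ?_
    by_contra heB
    rcases eq_or_ne e j with rfl | hej
    · linarith
    · exact he.ne (hd0 e heB hej)
  refine ⟨hle, fun hlj => hle.antisymm ?_⟩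
  have hnonneg := cost_nonneg_of_isMinOn (d := -d) hl hmin (fun e he => by simp [hdD e he])
    (by simp [hd]) fun e he => ?_
  · simp only [Pi.neg_apply, neg_mul, Finset.sum_neg_distrib, hcost] at hnonneg
    linarith
  by_cases heB : e ∈ B
  · exact hpos e heB
  rcases eq_or_ne e j with rfl | hej
  · exact (hl.1 e).lt_of_ne' hlj
  · simp [hd0 e heB hej] at he

/-- Linear programming duality: the weights of minimal cost `∑ e, l e * w e` that represent `z` are
supported on a cell, the dual solution being the supporting hyperplane. -/
theorem exists_isCell_mem_conicHull (hw : IsGeneric a w) (hz : InGeneralPosition a z)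
    (hcomp : IsCompact (weights a D z)) (hmem : z ∈ conicHull a D) :
    ∃ B, IsCell a w D B ∧ z ∈ conicHull a B := by
  classical
  obtain ⟨l, hl, hmin⟩ := hcomp.exists_isMinOn hmem (f := fun l => ∑ e, l e * w e) (by fun_prop)
  have hsupp : Submodule.span ℝ (a '' (({e | l e ≠ 0} : Finset E) : Set E)) = ⊤ :=
    hz _ (hl.2.2 ▸ sum_smul_mem_span a fun e he => by simpa using he)
  obtain ⟨B, hBl, hB⟩ := exists_isBasisSet_subset hsupp
  have hpos : ∀ e ∈ B, 0 < l e := fun e he =>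
    (hl.1 e).lt_of_ne' (by simpa using hBl he)
  have hBD : B ⊆ D := fun e he => by_contra fun h => (hpos e he).ne' (hl.2.1 e h)
  let y := hB.basis.constr ℝ fun e : B => w e
  have hy : ∀ e ∈ B, y (a e) = w e := fun e he => by
    simpa only [IsBasisSet.basis_apply] using hB.basis.constr_basis ℝ (fun e : B => w e) ⟨e, he⟩
  refine ⟨B, ⟨hBD, hB, y, hy, fun j hjD hj => ?_⟩, l, hl.1, fun j hj => ?_, hl.2.2⟩
  · exact (complementary_slackness_of_isMinOn hl hmin hB hpos hy hjD).1.lt_of_ne (hw B hB y hy j hj)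
  · by_contra hlj
    have hjD : j ∈ D := by_contra fun h => hlj (hl.2.1 j h)
    exact hw B hB y hy j hj ((complementary_slackness_of_isMinOn hl hmin hB hpos hy hjD).2 hlj)

theorem IsCell.sum_mul_lt (hB : IsCell a w D B) (hl : l ∈ weights a B z)
    (hl' : l' ∈ weights a D z) {e : E} (heB : e ∉ B) (he : l' e ≠ 0) :
    ∑ e, l e * w e < ∑ e, l' e * w e := by
  obtain ⟨y, hy, hlt⟩ := hB.exists_supporting
  have hzero : ∀ e, l e * (w e - y (a e)) = 0 := fun e => by
    by_cases he : e ∈ B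
    · simp [hy e he]
    · simp [hl.2.1 e he]
  have hnonneg : ∀ e, 0 ≤ l' e * (w e - y (a e)) := fun e => by
    by_cases heD : e ∈ D
    · by_cases heB : e ∈ B
      · simp [hy e heB]
      · exact mul_nonneg (hl'.1 e) (sub_nonneg.2 (hlt e heD heB).le)
    · simp [hl'.2.1 e heD]
  have heD : e ∈ D := by_contra fun h => he (hl'.2.1 e h)
  rw [sum_mul_eq_add_sum_mul_sub y w hl.2.2, sum_mul_eq_add_sum_mul_sub y w hl'.2.2,
    Finset.sum_eq_zero fun e _ => hzero e]
  exact add_lt_add_right (Finset.sum_pos' (fun e _ => hnonneg e)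
    ⟨e, Finset.mem_univ e, mul_pos ((hl'.1 e).lt_of_ne' he) (sub_pos.2 (hlt e heD heB))⟩) _

theorem IsCell.eq_of_mem_conicHull (hB : IsCell a w D B) (hB' : IsCell a w D B')
    (hz : InGeneralPosition a z) (h : z ∈ conicHull a B) (h' : z ∈ conicHull a B') : B = B' := by
  classical
  obtain ⟨l, hl⟩ := h
  obtain ⟨l', hl'⟩ := h'
  have hspan : Submodule.span ℝ (a '' ((B ∩ B' : Finset E) : Set E)) = ⊤ := by
    by_cases hlB : ∀ e ∉ B ∩ B', l e = 0
    · exact hz _ (hl.2.2 ▸ sum_smul_mem_span a hlB)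
    by_cases hlB' : ∀ e ∉ B ∩ B', l' e = 0
    · exact hz _ (hl'.2.2 ▸ sum_smul_mem_span a hlB')
    push Not at hlB hlB'
    obtain ⟨e, he, hle⟩ := hlB
    obtain ⟨e', he', hle'⟩ := hlB'
    have heB' : e ∉ B' := fun h => hle (hl.2.1 e fun hB => he (Finset.mem_inter.2 ⟨hB, h⟩))
    have heB : e' ∉ B := fun h => hle' (hl'.2.1 e' fun hB => he' (Finset.mem_inter.2 ⟨h, hB⟩))
    exact absurd (hB.sum_mul_lt hl (weights_mono hB'.subset hl') heB hle')
      (hB'.sum_mul_lt hl' (weights_mono hB.subset hl) heB' hle).not_gt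
  exact ((hB.isBasisSet.subset_of_span_eq_top Finset.inter_subset_left hspan).trans
    Finset.inter_subset_right).antisymm
    ((hB'.isBasisSet.subset_of_span_eq_top Finset.inter_subset_right hspan).trans
    Finset.inter_subset_left)

end Cone

section GenericHeights

theorem eventually_sum_mul_pow_ne {E : Type*} {idx : E → ℕ} {B : Finset E} {k : ℕ}
    (hk : ∀ e ∈ B, idx e ≠ k) (β : E → ℝ) :
    ∀ᶠ M : ℝ in atTop, ∑ e ∈ B, β e * M ^ idx e ≠ M ^ k := by
  let P : Polynomial ℝ := .X ^ k - ∑ e ∈ B, .C (β e) * .X ^ idx e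
  have hcoeff : P.coeff k = 1 := by
    simp only [P, Polynomial.coeff_sub, Polynomial.finsetSum_coeff, Polynomial.coeff_C_mul,
      Polynomial.coeff_X_pow, if_true]
    rw [Finset.sum_eq_zero fun e he => by rw [if_neg (hk e he).symm, mul_zero], sub_zero]
  have hP : P ≠ 0 := fun h => by simp [h] at hcoeff
  filter_upwards [P.eventually_atTop_not_isRoot hP] with M hM h
  exact hM (by simp [P, Polynomial.IsRoot, Polynomial.eval_finsetSum, h])

theorem eventually_sum_mul_pow_lt {E : Type*} {idx : E → ℕ} {B : Finset E} {k : ℕ}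
    (hk : ∀ e ∈ B, idx e < k) (β : E → ℝ) :
    ∀ᶠ M : ℝ in atTop, ∑ e ∈ B, β e * M ^ idx e < M ^ k := by
  have hlittle : (fun M : ℝ => ∑ e ∈ B, β e * M ^ idx e) =o[atTop] fun M : ℝ => M ^ k :=
    Asymptotics.IsLittleO.fun_sum fun e he =>
      (Asymptotics.isLittleO_pow_pow_atTop_of_lt (hk e he)).const_mul_left _
  filter_upwards [hlittle.def (c := 1 / 2) (by norm_num), eventually_gt_atTop 0] with M hM hpos
  have hpow : 0 < M ^ k := by positivity
  rw [Real.norm_eq_abs, Real.norm_eq_abs, abs_of_pos hpow] at hM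
  linarith [le_abs_self (∑ e ∈ B, β e * M ^ idx e)]

variable {E W : Type*} [Finite E] [AddCommGroup W] [Module ℝ W] {a : E → W} {B : Finset E}

theorem exists_injective_lt (D : Finset E) :
    ∃ idx : E → ℕ, Function.Injective idx ∧ ∀ e ∈ D, ∀ j ∉ D, idx e < idx j := by
  classical
  cases nonempty_fintype E
  let enum := Fintype.equivFin E
  have henum : ∀ e, (enum e : ℕ) < Fintype.card E := fun e => (enum e).2
  refine ⟨fun e => if e ∈ D then enum e else Fintype.card E + enum e, fun e e' h => ?_,
    fun e he j hj => ?_⟩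
  · refine enum.injective (Fin.ext ?_)
    have := henum e
    have := henum e'
    dsimp only at h
    split_ifs at h <;> omega
  · have := henum e
    simp only [he, hj, if_true, if_false]
    omega

theorem IsBasisSet.exists_eval_eq_sum (hB : IsBasisSet a B) (v : W) :
    ∃ β : E → ℝ, ∀ (w : E → ℝ) (y : W →ₗ[ℝ] ℝ), (∀ e ∈ B, y (a e) = w e) →
      y v = ∑ e ∈ B, β e * w e := by
  cases nonempty_fintype E
  obtain ⟨β, hβB, hβ⟩ := hB.exists_sum_smul_eq v
  refine ⟨β, fun w y hy => ?_⟩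
  rw [← hβ, map_sum, ← Finset.sum_subset (Finset.subset_univ B) fun e _ he => by simp [hβB e he]]
  exact Finset.sum_congr rfl fun e he => by rw [map_smul, smul_eq_mul, hy e he]

/- Giving the vectors outside `D` the highest powers of a large `M` as heights lifts them above the
hyperplanes through the cells of `D`, which therefore remain cells for every larger index set. -/
theorem exists_isGeneric_isCell_mono (a : E → W) (D : Finset E) :
    ∃ w : E → ℝ, IsGeneric a w ∧
      ∀ D', D ⊆ D' → ∀ B, IsCell a w D B → IsCell a w D' B := by
  obtain ⟨idx, hinj, hlt⟩ := exists_injective_lt D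
  have hgeneric : ∀ᶠ M : ℝ in atTop, ∀ B j, IsBasisSet a B → j ∉ B → ∀ y : W →ₗ[ℝ] ℝ,
      (∀ e ∈ B, y (a e) = M ^ idx e) → y (a j) ≠ M ^ idx j := by
    refine eventually_all.2 fun B => eventually_all.2 fun j =>
      eventually_imp_distrib_left.2 fun hB => eventually_imp_distrib_left.2 fun hj => ?_
    obtain ⟨β, hβ⟩ := hB.exists_eval_eq_sum (a j)
    filter_upwards [eventually_sum_mul_pow_ne (fun e he => hinj.ne (ne_of_mem_of_not_mem he hj)) β]
      with M hM y hy
    rwa [hβ (fun e => M ^ idx e) y hy]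
  have habove : ∀ᶠ M : ℝ in atTop, ∀ B j, IsBasisSet a B → B ⊆ D → j ∉ D → ∀ y : W →ₗ[ℝ] ℝ,
      (∀ e ∈ B, y (a e) = M ^ idx e) → y (a j) < M ^ idx j := by
    refine eventually_all.2 fun B => eventually_all.2 fun j =>
      eventually_imp_distrib_left.2 fun hB => eventually_imp_distrib_left.2 fun hBD =>
      eventually_imp_distrib_left.2 fun hj => ?_
    obtain ⟨β, hβ⟩ := hB.exists_eval_eq_sum (a j)
    filter_upwards [eventually_sum_mul_pow_lt (fun e he => hlt e (hBD he) j hj) β] with M hM y hy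
    rwa [hβ (fun e => M ^ idx e) y hy]
  obtain ⟨M, hM, hM'⟩ := (hgeneric.and habove).exists
  refine ⟨fun e => M ^ idx e, fun B hB y hy j hj => hM B j hB hj y hy, fun D' hD B hB => ?_⟩
  obtain ⟨y, hy, hlt⟩ := hB.exists_supporting
  refine ⟨hB.subset.trans hD, hB.isBasisSet, y, hy, fun e _ heB => ?_⟩
  by_cases he : e ∈ D
  · exact hlt e he heB
  · exact hM' B e hB.isBasisSet hB.subset he y hy

end GenericHeights

section Cayley

variable {ι E V : Type*} [AddCommGroup V] [Module ℝ V] {cls : E → ι} {pt : E → V} {t : ι → ℝ}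
  {x : V} {B D S : Finset E}

open Classical in
/-- The Cayley embedding of points `pt e` coloured by `cls e`: the convex hulls of the colour
classes are placed over the vertices of a simplex. -/
def cayley (cls : E → ι) (pt : E → V) (e : E) : (ι → ℝ) × V :=
  (Pi.single (cls e) 1, pt e)

/-- The section at `t` of the cone over the Cayley embedding of the points in `D`. For `t ≥ 0` it is
the Minkowski combination, with coefficients `t i`, of the convex hulls of the colour classes. -/
def cayleySection [Fintype E] (cls : E → ι) (pt : E → V) (D : Finset E) (t : ι → ℝ) : Set V :=
  {x | (t, x) ∈ conicHull (cayley cls pt) D}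

theorem convex_cayleySection [Fintype E] (cls : E → ι) (pt : E → V) (D : Finset E) (t : ι → ℝ) :
    Convex ℝ (cayleySection cls pt D t) :=
  (convex_conicHull (cayley cls pt) D).affine_preimage
    ((AffineMap.const ℝ V t).prod (AffineMap.id ℝ V))

open Classical in
theorem sum_smul_cayley_eq_iff [Fintype E] {l : E → ℝ} :
    ∑ e, l e • cayley cls pt e = (t, x) ↔
      (∀ i, ∑ e with cls e = i, l e = t i) ∧ ∑ e, l e • pt e = x := by
  simp [Prod.ext_iff, Prod.fst_sum, Prod.snd_sum, funext_iff, cayley, Finset.sum_filter,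
    Pi.single_apply, eq_comm]

theorem exists_mem_cls_eq (h : (t, x) ∈ Submodule.span ℝ (cayley cls pt '' (S : Set E))) {i : ι}
    (hi : t i ≠ 0) : ∃ e ∈ S, cls e = i := by
  by_contra! hc
  have hle : Submodule.span ℝ (cayley cls pt '' (S : Set E)) ≤
      LinearMap.ker (LinearMap.proj i ∘ₗ LinearMap.fst ℝ (ι → ℝ) V) := by
    rw [Submodule.span_le]
    rintro _ ⟨e, he, rfl⟩
    simp [cayley, (hc e he).symm]
  exact hi (by simpa using hle h)

theorem span_cayley_eq_top [Finite ι] (ht : ∀ i, t i ≠ 0)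
    (hmem : (t, x) ∈ Submodule.span ℝ (cayley cls pt '' (S : Set E)))
    (hinr : ∀ v : V, (0, v) ∈ Submodule.span ℝ (cayley cls pt '' (S : Set E))) :
    Submodule.span ℝ (cayley cls pt '' (S : Set E)) = ⊤ := by
  classical
  cases nonempty_fintype ι
  set H := Submodule.span ℝ (cayley cls pt '' (S : Set E))
  have hsingle : ∀ i, ((Pi.single i 1 : ι → ℝ), (0 : V)) ∈ H := fun i => by
    obtain ⟨e, he, rfl⟩ := exists_mem_cls_eq hmem (ht i)
    have he' : cayley cls pt e ∈ H := Submodule.subset_span ⟨e, he, rfl⟩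
    have := H.sub_mem he' (hinr (pt e))
    simp only [cayley, Prod.mk_sub_mk, sub_zero, sub_self] at this
    convert this
  refine eq_top_iff.2 fun ⟨s, v⟩ _ => ?_
  have hdecomp : (s, v) = ∑ i, s i • ((Pi.single i 1 : ι → ℝ), (0 : V)) + (0, v) := by
    ext j
    · simp [Prod.fst_sum, Pi.single_apply]
    · simp [Prod.snd_sum]
  rw [hdecomp]
  exact H.add_mem (H.sum_mem fun i _ => H.smul_mem _ (hsingle i)) (hinr v)

end Cayley

section Subdivision

variable {ι E V : Type*} [NormedAddCommGroup V] [NormedSpace ℝ V]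
  {cls : E → ι} {pt : E → V} {t : ι → ℝ} {B D : Finset E}

theorem isCompact_weights_cayley [Fintype E] (cls : E → ι) (pt : E → V) (D : Finset E)
    (z : (ι → ℝ) × V) : IsCompact (weights (cayley cls pt) D z) := by
  classical
  refine (isCompact_Icc (a := (0 : E → ℝ)) (b := fun e => z.1 (cls e))).of_isClosed_subset
    (isClosed_weights _ _ _) fun l hl => ⟨hl.1, fun e => ?_⟩
  change l e ≤ z.1 (cls e)
  rw [← (sum_smul_cayley_eq_iff.1 hl.2.2).1 (cls e)]
  exact Finset.single_le_sum (fun e _ => hl.1 e) (by simp)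

variable [FiniteDimensional ℝ V] [MeasurableSpace V] [BorelSpace V] (μ : Measure V)
  [μ.IsAddHaarMeasure]

theorem ae_inGeneralPosition_cayley [Finite ι] [Countable E] (cls : E → ι) (pt : E → V)
    (ht : ∀ i, t i ≠ 0) : ∀ᵐ x ∂μ, InGeneralPosition (cayley cls pt) (t, x) := by
  refine ae_all_iff.2 fun S => ?_
  set H := Submodule.span ℝ (cayley cls pt '' (S : Set E))
  by_cases htop : H = ⊤
  · exact .of_forall fun _ _ => htop
  rcases Set.eq_empty_or_nonempty {x | (t, x) ∈ H} with h | ⟨x₀, hx₀⟩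
  · exact .of_forall fun x hx => (Set.eq_empty_iff_forall_notMem.1 h x hx).elim
  have hproper : H.comap (LinearMap.inr ℝ (ι → ℝ) V) ≠ ⊤ := fun h =>
    htop (span_cayley_eq_top ht hx₀ fun v => Submodule.eq_top_iff'.1 h v)
  have hnull := Measure.addHaar_submodule μ _ hproper
  rw [← measure_preimage_add_right μ (-x₀)] at hnull
  filter_upwards [measure_eq_zero_iff_ae_notMem.1 hnull] with x hx hxH
  refine (hx ?_).elim
  simpa [← sub_eq_add_neg] using H.sub_mem hxH hx₀

open Classical in
theorem measure_cayleySection_eq_sum [Finite ι] [Fintype E] (ht : ∀ i, t i ≠ 0) {w : E → ℝ}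
    (hw : IsGeneric (cayley cls pt) w) (D : Finset E) :
    μ (cayleySection cls pt D t) =
      ∑ B with IsCell (cayley cls pt) w D B, μ (cayleySection cls pt B t) := by
  have hgen := ae_inGeneralPosition_cayley μ cls pt ht
  have hcover : cayleySection cls pt D t =ᵐ[μ]
      ⋃ B ∈ ({B | IsCell (cayley cls pt) w D B} : Finset (Finset E)), cayleySection cls pt B t := by
    filter_upwards [hgen] with x hx
    refine propext ⟨fun hmem => ?_, fun hmem => ?_⟩
    · obtain ⟨B, hB, hxB⟩ :=
        exists_isCell_mem_conicHull hw hx (isCompact_weights_cayley _ _ _ _) hmem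
      exact Set.mem_biUnion (by simpa using hB) hxB
    · obtain ⟨B, hB, hxB⟩ := Set.mem_iUnion₂.1 hmem
      exact conicHull_mono (Finset.mem_filter.1 hB).2.subset hxB
  rw [measure_congr hcover, measure_biUnion_finset₀]
  · intro B hB B' hB' hne
    simp only [Finset.coe_filter_univ, Set.mem_ofPred_eq] at hB hB'
    refine measure_eq_zero_iff_ae_notMem.2 ?_
    filter_upwards [hgen] with x hx ⟨h, h'⟩
    exact hne (hB.eq_of_mem_conicHull hB' hx h h')
  · exact fun B _ => (convex_cayleySection cls pt B t).nullMeasurableSet μ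

end Subdivision

section SimplicialSection

theorem exists_prod_eq_prod_mul_prod {ι E : Type*} [Fintype ι] {B : Finset E} {cls : E → ι}
    (hcls : ∀ i, ∃ e ∈ B, cls e = i) {n : ℕ} (hB : B.card = Fintype.card ι + n) :
    ∃ J : Fin n → ι, ∀ t : ι → ℝ, ∏ e ∈ B, t (cls e) = (∏ i, t i) * ∏ k, t (J k) := by
  classical
  choose r hrB hr using hcls
  have hinj : Function.Injective r := fun i j h => by rw [← hr i, h, hr]
  have hsub : Finset.univ.image r ⊆ B := Finset.image_subset_iff.2 fun i _ => hrB i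
  have hcard : (B \ Finset.univ.image r).card = n := by
    rw [Finset.card_sdiff_of_subset hsub, Finset.card_image_of_injective _ hinj, Finset.card_univ,
      hB, Nat.add_sub_cancel_left]
  let enum := (Finset.equivFinOfCardEq hcard).symm
  refine ⟨fun k => cls (enum k), fun t => ?_⟩
  rw [← Finset.prod_sdiff hsub, mul_comm, Finset.prod_image hinj.injOn,
    ← Finset.prod_coe_sort (B \ _), ← Equiv.prod_comp enum]
  simp only [hr]

theorem det_eq_det_mul_det_of_fst {R M N : Type*} [CommRing R] [AddCommGroup M] [Module R M]
    [AddCommGroup N] [Module R N] [Module.Free R M] [Module.Finite R M] [Module.Free R N]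
    [Module.Finite R N] (f : M × N →ₗ[R] M × N) (g : M →ₗ[R] M) (hf : ∀ z, (f z).1 = g z.1) :
    LinearMap.det f =
      LinearMap.det g * LinearMap.det (LinearMap.snd R M N ∘ₗ f ∘ₗ LinearMap.inr R M N) := by
  classical
  let b := Module.Free.chooseBasis R M
  let b' := Module.Free.chooseBasis R N
  rw [← LinearMap.det_toMatrix (b.prod b'), ← LinearMap.det_toMatrix b,
    ← LinearMap.det_toMatrix b', ← Matrix.det_fromBlocks_zero₁₂ _
      (LinearMap.toMatrix b b' (LinearMap.snd R M N ∘ₗ f ∘ₗ LinearMap.inl R M N))]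
  congr 1
  ext (i | i) (j | j) <;> simp [LinearMap.toMatrix_apply, hf]

variable {ι E V : Type*} {B : Finset E}

theorem IsBasisSet.repr_sum_smul [Fintype E] {W : Type*} [AddCommGroup W] [Module ℝ W] {a : E → W}
    (hB : IsBasisSet a B) {l : E → ℝ} (hl : ∀ e ∉ B, l e = 0) (e : B) :
    hB.basis.repr (∑ e, l e • a e) e = l e := by
  have hsum : ∑ e, l e • a e = ∑ e : B, l e • hB.basis e := by
    simp only [IsBasisSet.basis_apply]
    rw [Finset.sum_coe_sort B fun e => l e • a e]
    exact (Finset.sum_subset (Finset.subset_univ B) fun e _ he => by simp [hl e he]).symm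
  rw [hsum, hB.basis.repr_sum_self]

theorem IsBasisSet.mem_conicHull_iff [Fintype E] {W : Type*} [AddCommGroup W] [Module ℝ W]
    {a : E → W} (hB : IsBasisSet a B) {z : W} :
    z ∈ conicHull a B ↔ ∀ e, 0 ≤ hB.basis.repr z e := by
  constructor
  · rintro ⟨l, h0, hlB, rfl⟩ e
    simpa only [hB.repr_sum_smul hlB] using h0 e
  · intro h
    obtain ⟨β, hβB, rfl⟩ := hB.exists_sum_smul_eq z
    refine ⟨β, fun e => ?_, hβB, rfl⟩
    by_cases he : e ∈ B
    · simpa only [hB.repr_sum_smul hβB] using h ⟨e, he⟩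
    · exact (hβB e he).ge

section Scaling

variable [AddCommGroup V] [Module ℝ V] {cls : E → ι} {pt : E → V}

open Classical in
/-- The linear map that multiplies each vector `cayley cls pt e`, `e ∈ B`, of a basis by
`t (cls e)`. It multiplies the first coordinate by `t`, and hence maps the section at `1` of the
cone over `B` to the section at `t`. -/
def scaleBasis (hB : IsBasisSet (cayley cls pt) B) (t : ι → ℝ) :
    (ι → ℝ) × V →ₗ[ℝ] (ι → ℝ) × V :=
  Matrix.toLin hB.basis hB.basis (Matrix.diagonal fun e => t (cls e))

theorem repr_scaleBasis (hB : IsBasisSet (cayley cls pt) B) (t : ι → ℝ) (z : (ι → ℝ) × V)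
    (e : B) : hB.basis.repr (scaleBasis hB t z) e = t (cls e) * hB.basis.repr z e := by
  simp [scaleBasis, Matrix.repr_toLin, Matrix.mulVec_diagonal]

theorem det_scaleBasis (hB : IsBasisSet (cayley cls pt) B) (t : ι → ℝ) :
    LinearMap.det (scaleBasis hB t) = ∏ e ∈ B, t (cls e) := by
  classical
  rw [scaleBasis, LinearMap.det_toLin, Matrix.det_diagonal,
    Finset.prod_coe_sort B fun e => t (cls e)]

theorem fst_scaleBasis (hB : IsBasisSet (cayley cls pt) B) (t : ι → ℝ) (z : (ι → ℝ) × V) :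
    (scaleBasis hB t z).1 = t * z.1 := by
  suffices LinearMap.fst ℝ (ι → ℝ) V ∘ₗ scaleBasis hB t =
      LinearMap.mulLeft ℝ t ∘ₗ LinearMap.fst ℝ (ι → ℝ) V from LinearMap.congr_fun this z
  refine hB.basis.ext fun e => ?_
  simp only [LinearMap.comp_apply, scaleBasis, Matrix.toLin_self]
  ext i
  rcases eq_or_ne (cls e) i with rfl | hi
  · simp [cayley, Matrix.diagonal_apply]
  · simp [cayley, Matrix.diagonal_apply, hi]

variable [Fintype ι] [FiniteDimensional ℝ V]

theorem card_of_isBasisSet_cayley {n : ℕ} (hn : Module.finrank ℝ V = n)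
    (hB : IsBasisSet (cayley cls pt) B) : B.card = Fintype.card ι + n := by
  have := Module.finrank_eq_card_basis hB.basis
  rwa [Module.finrank_prod, Module.finrank_fintype_fun_eq_card, hn, Fintype.card_coe, eq_comm]
    at this

theorem prod_mul_det_fiber_scaleBasis (hB : IsBasisSet (cayley cls pt) B) (t : ι → ℝ) :
    (∏ i, t i) * LinearMap.det
        (LinearMap.snd ℝ (ι → ℝ) V ∘ₗ scaleBasis hB t ∘ₗ LinearMap.inr ℝ (ι → ℝ) V) =
      ∏ e ∈ B, t (cls e) := by
  have hmul : LinearMap.det (LinearMap.mulLeft ℝ t) = ∏ i, t i := by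
    change LinearMap.det (LinearMap.pi fun i => (LinearMap.mulLeft ℝ (t i)).comp
      (LinearMap.proj i)) = _
    simp only [LinearMap.det_pi, LinearMap.det_mulLeft]
  rw [← det_scaleBasis hB t,
    det_eq_det_mul_det_of_fst _ (LinearMap.mulLeft ℝ t) (fst_scaleBasis hB t), hmul]

end Scaling

variable [NormedAddCommGroup V] [NormedSpace ℝ V] [FiniteDimensional ℝ V]
  {cls : E → ι} {pt : E → V}

theorem exists_measure_cayleySection_eq [Finite ι] [Fintype E] [MeasurableSpace V] [BorelSpace V]
    (μ : Measure V) [μ.IsAddHaarMeasure] {n : ℕ} (hn : Module.finrank ℝ V = n)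
    (hB : IsBasisSet (cayley cls pt) B) :
    ∃ J : Fin n → ι, ∀ t : ι → ℝ, (∀ i, 0 < t i) →
      μ (cayleySection cls pt B t) =
        ENNReal.ofReal (∏ k, t (J k)) * μ (cayleySection cls pt B 1) := by
  cases nonempty_fintype ι
  have hcls : ∀ i, ∃ e ∈ B, cls e = i := fun i =>
    exists_mem_cls_eq (t := 1) (x := 0) (hB.span_eq_top ▸ Submodule.mem_top) one_ne_zero
  obtain ⟨J, hJ⟩ := exists_prod_eq_prod_mul_prod hcls (card_of_isBasisSet_cayley hn hB)
  refine ⟨J, fun t ht => ?_⟩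
  let T : V →ₗ[ℝ] V := LinearMap.snd ℝ _ _ ∘ₗ scaleBasis hB t ∘ₗ LinearMap.inr ℝ _ _
  have hdet : LinearMap.det T = ∏ k, t (J k) :=
    mul_left_cancel₀ (Finset.prod_ne_zero_iff.2 fun i _ => (ht i).ne')
      ((prod_mul_det_fiber_scaleBasis hB t).trans (hJ t))
  have hpos : 0 < ∏ k, t (J k) := Finset.prod_pos fun k _ => ht (J k)
  let c : V := (scaleBasis hB t (1, 0)).2
  have hscale : ∀ x, scaleBasis hB t (1, x) = (t, T x + c) := fun x =>
    Prod.ext (by rw [fst_scaleBasis, mul_one]) (by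
      have hsplit : ((1 : ι → ℝ), x) = (0, x) + (1, 0) := by simp
      rw [hsplit, map_add]
      rfl)
  have hpre : cayleySection cls pt B 1 = T ⁻¹' ((· + c) ⁻¹' cayleySection cls pt B t) := by
    ext x
    change (1, x) ∈ conicHull _ B ↔ (t, T x + c) ∈ conicHull _ B
    rw [← hscale, hB.mem_conicHull_iff, hB.mem_conicHull_iff]
    simp only [repr_scaleBasis, mul_nonneg_iff_of_pos_left (ht _)]
  rw [hpre, Measure.addHaar_preimage_linearMap μ (hdet ▸ hpos.ne'), measure_preimage_add_right,
    hdet, abs_of_pos (inv_pos.2 hpos), ← mul_assoc, ← ENNReal.ofReal_mul hpos.le,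
    mul_inv_cancel₀ hpos.ne', ENNReal.ofReal_one, one_mul]

theorem exists_coeff_cayleySection [Fintype ι] [Fintype E] [MeasurableSpace V] [BorelSpace V]
    (μ : Measure V) [μ.IsAddHaarMeasure] {n : ℕ} (hn : Module.finrank ℝ V = n)
    (cls : E → ι) (pt : E → V) {D₀ D₁ : Finset E} (hD : D₀ ⊆ D₁) :
    ∃ c₀ c₁ : (Fin n → ι) → ℝ≥0∞, c₀ ≤ c₁ ∧ ∀ t : ι → ℝ, (∀ i, 0 < t i) →
      μ (cayleySection cls pt D₀ t) = ∑ J, ENNReal.ofReal (∏ k, t (J k)) * c₀ J ∧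
      μ (cayleySection cls pt D₁ t) = ∑ J, ENNReal.ofReal (∏ k, t (J k)) * c₁ J := by
  classical
  obtain ⟨w, hw, hmono⟩ := exists_isGeneric_isCell_mono (cayley cls pt) D₀
  have hcell : ∀ B, IsBasisSet (cayley cls pt) B → ∃ c : (Fin n → ι) → ℝ≥0∞,
      ∀ t : ι → ℝ, (∀ i, 0 < t i) →
        μ (cayleySection cls pt B t) = ∑ J, ENNReal.ofReal (∏ k, t (J k)) * c J := by
    intro B hB
    obtain ⟨J, hJ⟩ := exists_measure_cayleySection_eq μ hn hB
    exact ⟨Pi.single J (μ (cayleySection cls pt B 1)), fun t ht => by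
      simp [hJ t ht, Pi.single_apply]⟩
  choose! c hc using hcell
  let coeff (D : Finset E) (J : Fin n → ι) : ℝ≥0∞ := ∑ B with IsCell (cayley cls pt) w D B, c B J
  have hexp : ∀ D t, (∀ i, 0 < t i) →
      μ (cayleySection cls pt D t) = ∑ J, ENNReal.ofReal (∏ k, t (J k)) * coeff D J := by
    intro D t ht
    rw [measure_cayleySection_eq_sum μ (fun i => (ht i).ne') hw]
    simp only [coeff, Finset.mul_sum]
    rw [Finset.sum_comm]
    exact Finset.sum_congr rfl fun B hB => hc B (Finset.mem_filter.1 hB).2.isBasisSet t ht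
  exact ⟨coeff D₀, coeff D₁,
    fun J => Finset.sum_le_sum_of_subset
      (Finset.monotone_filter_right _ fun B _ => hmono D₁ hD B),
    fun t ht => ⟨hexp D₀ t ht, hexp D₁ t ht⟩⟩

end SimplicialSection

section Polytopes

open Classical in
theorem cayleySection_eq_sum_smul_convexHull {ι E V : Type*} [Fintype ι] [Fintype E]
    [AddCommGroup V] [Module ℝ V] (cls : E → ι) (pt : E → V) (D : Finset E) {t : ι → ℝ}
    (ht : ∀ i, 0 < t i) :
    cayleySection cls pt D t =
      ∑ i, t i • convexHull ℝ (pt '' {e | e ∈ D ∧ cls e = i}) := by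
  ext x
  rw [Set.mem_fintype_sum]
  constructor
  · rintro ⟨l, hl0, hlD, hlx⟩
    obtain ⟨hsum, hx⟩ := sum_smul_cayley_eq_iff.1 hlx
    refine ⟨fun i => ∑ e with cls e = i, l e • pt e, fun i => ?_,
      hx ▸ Finset.sum_fiberwise _ cls _⟩
    have hsub : ({e | e ∈ D ∧ cls e = i} : Finset E) ⊆ ({e | cls e = i} : Finset E) :=
      fun e => by simp
    have hD : ∀ e ∈ ({e | cls e = i} : Finset E), e ∉ ({e | e ∈ D ∧ cls e = i} : Finset E) →
        l e = 0 := fun e he he' => hlD e (by simp_all)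
    have hmass : ∑ e with e ∈ D ∧ cls e = i, l e = t i :=
      (Finset.sum_subset hsub hD).trans (hsum i)
    have hpoint : ∑ e with e ∈ D ∧ cls e = i, l e • pt e = ∑ e with cls e = i, l e • pt e :=
      Finset.sum_subset hsub fun e he he' => by rw [hD e he he', zero_smul]
    rw [Set.mem_smul_set_iff_inv_smul_mem₀ (ht i).ne']
    beta_reduce
    rw [← hpoint, ← hmass]
    exact Finset.centerMass_mem_convexHull _ (fun e _ => hl0 e) (hmass ▸ ht i)
      fun e he => ⟨e, by simpa using he, rfl⟩
  · rintro ⟨g, hg, rfl⟩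
    choose y hy hyg using fun i => Set.mem_smul_set.1 (hg i)
    have hvertex : ∀ i, (Pi.single i 1, y i) ∈ conicHull (cayley cls pt) D := fun i =>
      convexHull_min (t := cayleySection cls pt D (Pi.single i 1))
        (by rintro _ ⟨e, ⟨he, rfl⟩, rfl⟩; exact mem_conicHull_of_mem (a := cayley cls pt) he)
        (convex_cayleySection cls pt D _) (hy i)
    have hsum : (t, ∑ i, g i) = ∑ i, t i • ((Pi.single i 1 : ι → ℝ), y i) :=
      Prod.ext (by ext; simp [Prod.fst_sum, Pi.single_apply]) (by simp [Prod.snd_sum, hyg])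
    change (t, _) ∈ conicHull (cayley cls pt) D
    rw [hsum]
    exact sum_smul_mem_conicHull (fun i _ => (ht i).le) fun i _ => hvertex i

theorem ofReal_sum_mul {α : Type*} [Fintype α] {p c : α → ℝ} (hp : ∀ a, 0 ≤ p a)
    (hc : ∀ a, 0 ≤ c a) :
    ENNReal.ofReal (∑ a, p a * c a) = ∑ a, ENNReal.ofReal (p a) * ENNReal.ofReal (c a) := by
  rw [ENNReal.ofReal_sum_of_nonneg fun a _ => mul_nonneg (hp a) (hc a)]
  simp only [ENNReal.ofReal_mul (hp _)]

theorem toReal_sum_ofReal_mul {α : Type*} [Fintype α] {p : α → ℝ} {c : α → ℝ≥0∞}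
    (hp : ∀ a, 0 ≤ p a) (hc : ∀ a, c a ≠ ⊤) :
    (∑ a, ENNReal.ofReal (p a) * c a).toReal = ∑ a, p a * (c a).toReal := by
  rw [ENNReal.toReal_sum fun a _ => ENNReal.mul_ne_top ENNReal.ofReal_ne_top (hc a)]
  simp only [ENNReal.toReal_mul, ENNReal.toReal_ofReal (hp _)]

variable {ι V : Type*} [Fintype ι] [NormedAddCommGroup V] [NormedSpace ℝ V] {A : ι → Set V}
  {n : ℕ} {t : ι → ℝ}

theorem isCompact_sum_smul (hA : ∀ i, IsCompact (A i)) (t : ι → ℝ) :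
    IsCompact (∑ i, t i • A i) :=
  Finset.sum_induction _ IsCompact (fun _ _ => IsCompact.add) isCompact_singleton
    fun i _ => (hA i).smul (t i)

/-- For positive `t`, the volume of the Minkowski combination `∑ t i • A i` is the homogeneous
polynomial in `t` with coefficients `c`. -/
def IsVolumeExpansion [MeasurableSpace V] (μ : Measure V) (A : ι → Set V)
    (c : (Fin n → ι) → ℝ) : Prop :=
  ∀ t : ι → ℝ, (∀ i, 0 < t i) → μ.real (∑ i, t i • A i) = ∑ J, (∏ k, t (J k)) * c J

variable [FiniteDimensional ℝ V] [MeasurableSpace V] [BorelSpace V] (μ : Measure V)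
  [μ.IsAddHaarMeasure]

theorem exists_isVolumeExpansion_convexHull (hn : Module.finrank ℝ V = n) {U W : ι → Finset V}
    (hUW : ∀ i, U i ⊆ W i) :
    ∃ c₀ c₁ : (Fin n → ι) → ℝ, 0 ≤ c₀ ∧ c₀ ≤ c₁ ∧
      IsVolumeExpansion μ (fun i => convexHull ℝ (U i : Set V)) c₀ ∧
      IsVolumeExpansion μ (fun i => convexHull ℝ (W i : Set V)) c₁ := by
  classical
  obtain ⟨c₀, c₁, hle, h⟩ := exists_coeff_cayleySection μ hn (Sigma.fst : (Σ i, W i) → ι)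
    (fun e => (e.2 : V)) (D₀ := {e | (e.2 : V) ∈ U e.1}) (Finset.subset_univ _)
  have hU : ∀ i, (fun e : Σ i, W i => (e.2 : V)) ''
      {e | e ∈ ({e | (e.2 : V) ∈ U e.1} : Finset (Σ i, W i)) ∧ e.1 = i} = U i := fun i => by
    ext v
    simpa using fun hv => hUW i hv
  have hW : ∀ i, (fun e : Σ i, W i => (e.2 : V)) '' {e | e ∈ Finset.univ ∧ e.1 = i} = W i :=
    fun i => by ext v; simp
  have hc₁ : ∀ J, c₁ J ≠ ⊤ := by
    have hone := (h 1 fun _ => one_pos).2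
    rw [cayleySection_eq_sum_smul_convexHull _ _ _ (t := 1) fun _ => one_pos] at hone
    simp only [hW, Pi.one_apply, Finset.prod_const_one, ENNReal.ofReal_one, one_mul] at hone
    have hfin : ∑ J, c₁ J ≠ ⊤ := by
      have hcompact := isCompact_sum_smul (fun i => (W i).finite_toSet.isCompact_convexHull ℝ) 1
      simpa only [← hone, Pi.one_apply] using (hcompact.measure_lt_top (μ := μ)).ne
    exact fun J => ENNReal.sum_ne_top.1 hfin J (Finset.mem_univ J)
  have hc₀ : ∀ J, c₀ J ≠ ⊤ := fun J => ne_top_of_le_ne_top (hc₁ J) (hle J)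
  refine ⟨fun J => (c₀ J).toReal, fun J => (c₁ J).toReal, fun J => ENNReal.toReal_nonneg,
    fun J => ENNReal.toReal_mono (hc₁ J) (hle J), fun t ht => ?_, fun t ht => ?_⟩
  · rw [← toReal_sum_ofReal_mul (fun J => Finset.prod_nonneg fun k _ => (ht _).le) hc₀,
      ← (h t ht).1, cayleySection_eq_sum_smul_convexHull _ _ _ ht]
    simp only [hU, measureReal_def]
  · rw [← toReal_sum_ofReal_mul (fun J => Finset.prod_nonneg fun k _ => (ht _).le) hc₁,
      ← (h t ht).2, cayleySection_eq_sum_smul_convexHull _ _ _ ht]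
    simp only [hW, measureReal_def]

theorem tendsto_measure_add_smul {K Q : Set V} (hK : IsCompact K) (hQ : IsCompact Q)
    (hQne : Q.Nonempty) :
    Tendsto (fun s : ℝ => μ (K + s • Q)) (𝓝[>] 0) (𝓝 (μ K)) := by
  obtain ⟨R, hR⟩ := hQ.isBounded.subset_closedBall 0
  have hthick : Tendsto (fun s : ℝ => μ (Metric.cthickening (s * R) K)) (𝓝[>] 0) (𝓝 (μ K)) := by
    refine (tendsto_measure_cthickening_of_isCompact hK).comp ?_
    exact tendsto_nhdsWithin_of_tendsto_nhds (Continuous.tendsto' (by fun_prop) _ _ (zero_mul R))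
  obtain ⟨q, hq⟩ := hQne
  refine tendsto_of_tendsto_of_tendsto_of_le_of_le' tendsto_const_nhds hthick
    (.of_forall fun s => ?_) ?_
  · rw [← measure_preimage_add_right μ (-(s • q)) K, ← Set.image_add_right]
    exact measure_mono (Set.image_subset_iff.2 fun x hx =>
      Set.add_mem_add hx (Set.smul_mem_smul_set hq))
  · filter_upwards [eventually_mem_nhdsWithin] with s (hs : 0 < s)
    refine measure_mono ?_
    rintro _ ⟨x, hx, _, ⟨q, hq, rfl⟩, rfl⟩
    refine Metric.mem_cthickening_of_dist_le _ x _ _ hx ?_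
    have hqR : ‖q‖ ≤ R := by simpa using hR hq
    simpa [norm_smul, abs_of_pos hs] using mul_le_mul_of_nonneg_left hqR hs.le

theorem IsVolumeExpansion.of_nonneg {μ : Measure V} [μ.IsAddHaarMeasure] {c : (Fin n → ι) → ℝ}
    (h : IsVolumeExpansion μ A c) (hconv : ∀ i, Convex ℝ (A i)) (hA : ∀ i, IsCompact (A i))
    (hne : ∀ i, (A i).Nonempty) (ht : ∀ i, 0 ≤ t i) :
    μ.real (∑ i, t i • A i) = ∑ J, (∏ k, t (J k)) * c J := by
  have hone : ∑ i, A i = ∑ i, (1 : ℝ) • A i := by simp only [one_smul]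
  have hshift : ∀ s : ℝ, 0 < s → ∑ i, (t i + s) • A i = ∑ i, t i • A i + s • ∑ i, A i := by
    intro s hs
    rw [Finset.smul_sum, ← Finset.sum_add_distrib]
    exact Finset.sum_congr rfl fun i _ => (hconv i).add_smul (ht i) hs.le
  have hpoly : Tendsto (fun s : ℝ => ∑ J, (∏ k, (t (J k) + s)) * c J) (𝓝[>] 0)
      (𝓝 (∑ J, (∏ k, t (J k)) * c J)) :=
    tendsto_nhdsWithin_of_tendsto_nhds (Continuous.tendsto' (by fun_prop) _ _ (by simp))
  have hvol := (ENNReal.tendsto_toReal (isCompact_sum_smul hA t).measure_lt_top.ne).comp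
    (tendsto_measure_add_smul μ (isCompact_sum_smul hA t) (hone ▸ isCompact_sum_smul hA 1)
      (Finset.sum_induction _ Set.Nonempty (fun _ _ => Set.Nonempty.add) Set.zero_nonempty
        fun i _ => hne i))
  refine tendsto_nhds_unique hvol (hpoly.congr' ?_)
  filter_upwards [eventually_mem_nhdsWithin] with s hs
  rw [← h _ fun i => add_pos_of_nonneg_of_pos (ht i) hs, hshift s hs]
  rfl

end Polytopes

section Polarization

variable {κ : Type*} [Fintype κ] [DecidableEq κ]

theorem sum_neg_one_pow_card_compl_of_subset (A : Finset κ) :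
    ∑ S with A ⊆ S, (-1 : ℤ) ^ Sᶜ.card = if A = Finset.univ then 1 else 0 := by
  calc ∑ S with A ⊆ S, (-1 : ℤ) ^ Sᶜ.card = ∑ T ∈ Aᶜ.powerset, (-1 : ℤ) ^ T.card :=
        Finset.sum_nbij' compl compl (by simp) (fun T hT => by
          simpa [Finset.subset_compl_comm] using hT) (by simp) (by simp) (by simp)
    _ = if A = Finset.univ then 1 else 0 := by
        rw [Finset.sum_powerset_neg_one_pow_card]
        simp only [Finset.compl_eq_empty_iff]

theorem sum_perm_eq_sum_filter_image_eq_univ {N : Type*} [AddCommMonoid N] (g : (κ → κ) → N) :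
    ∑ σ : Equiv.Perm κ, g σ = ∑ θ with Finset.univ.image θ = Finset.univ, g θ := by
  refine Finset.sum_nbij (fun σ => σ) (fun σ _ => by simp) DFunLike.coe_injective.injOn
    (fun θ hθ => ?_) fun _ _ => rfl
  have himage : Finset.univ.image θ = Finset.univ := by simpa using hθ
  have hsurj : Function.Surjective θ := fun y => by
    simpa using himage.ge (Finset.mem_univ y)
  exact ⟨.ofBijective θ (Finite.surjective_iff_bijective.1 hsurj), by simp⟩

theorem sum_neg_one_pow_smul_map_sum {R M N : Type*} [CommSemiring R] [AddCommMonoid M]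
    [Module R M] [AddCommGroup N] [Module R N] (f : MultilinearMap R (fun _ : κ => M) N)
    (x : κ → M) :
    ∑ S : Finset κ, (-1 : ℤ) ^ Sᶜ.card • f (fun _ => ∑ j ∈ S, x j) =
      ∑ σ : Equiv.Perm κ, f (x ∘ σ) := by
  have hexpand : ∀ S : Finset κ, f (fun _ => ∑ j ∈ S, x j) =
      ∑ θ : κ → κ, if Finset.univ.image θ ⊆ S then f (x ∘ θ) else 0 := fun S => by
    rw [f.map_sum_finset, ← Finset.sum_filter]
    refine Finset.sum_congr ?_ fun _ _ => rfl
    ext θ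
    simp [Fintype.mem_piFinset, Finset.image_subset_iff]
  simp only [hexpand, Finset.smul_sum, smul_ite, smul_zero]
  rw [Finset.sum_comm, sum_perm_eq_sum_filter_image_eq_univ fun θ => f (x ∘ θ), Finset.sum_filter]
  refine Finset.sum_congr rfl fun θ _ => ?_
  rw [← Finset.sum_filter, ← Finset.sum_smul, sum_neg_one_pow_card_compl_of_subset, ite_smul,
    one_smul, zero_smul]

theorem sum_neg_one_pow_mul_eval {ι : Type*} [Fintype ι] [DecidableEq ι] {n : ℕ}
    (c : (Fin n → ι) → ℝ) (I : Fin n → ι) :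
    ∑ S : Finset (Fin n), (-1 : ℝ) ^ (n - S.card) *
        ∑ J : Fin n → ι, (∏ k, (∑ j ∈ S, (Pi.single (I j) 1 : ι → ℝ)) (J k)) * c J =
      ∑ σ : Equiv.Perm (Fin n), c (I ∘ σ) := by
  let f : MultilinearMap ℝ (fun _ : Fin n => ι → ℝ) ℝ :=
    ∑ J, c J • (MultilinearMap.mkPiAlgebra ℝ (Fin n) ℝ).compLinearMap fun k => LinearMap.proj (J k)
  have hf : ∀ x, f x = ∑ J, (∏ k, x k (J k)) * c J := fun x => by
    simp [f, mul_comm]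
  have hsingle : ∀ I : Fin n → ι, f (fun k => Pi.single (I k) 1) = c I := fun I => by
    rw [hf, Finset.sum_eq_single I (fun J _ hJ => ?_) (by simp)]
    · simp
    · obtain ⟨k, hk⟩ := Function.ne_iff.1 hJ
      rw [Finset.prod_eq_zero (Finset.mem_univ k) (Pi.single_eq_of_ne hk 1), zero_mul]
  have hpolar := sum_neg_one_pow_smul_map_sum f fun k => Pi.single (I k) 1
  simp only [hf, Finset.card_compl, Fintype.card_fin, zsmul_eq_mul, Int.cast_pow, Int.cast_neg,
    Int.cast_one] at hpolar
  rw [hpolar]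
  simp only [← hf]
  exact Finset.sum_congr rfl fun σ _ => hsingle (I ∘ σ)

end Polarization

section MixedVolume

theorem coe_sum_convexBody {κ V : Type*} [NormedAddCommGroup V] [NormedSpace ℝ V]
    (S : Finset κ) (L : κ → ConvexBody V) :
    ((∑ j ∈ S, L j : ConvexBody V) : Set V) = ∑ j ∈ S, (L j : Set V) := by
  classical
  induction S using Finset.induction_on with
  | empty => simp
  | insert j S hj ih => rw [Finset.sum_insert hj, Finset.sum_insert hj, ConvexBody.coe_add, ih]

theorem sum_comp_eq_sum_smul {κ ι V : Type*} [Fintype ι] [DecidableEq ι] [AddCommGroup V]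
    [Module ℝ V] {A : ι → Set V} (hA : ∀ i, Convex ℝ (A i)) (hne : ∀ i, (A i).Nonempty)
    (I : κ → ι) (S : Finset κ) :
    ∑ j ∈ S, A (I j) = ∑ i, (∑ j ∈ S, (Pi.single (I j) 1 : ι → ℝ)) i • A i := by
  classical
  have hsingle : ∀ i₀, A i₀ = ∑ i, (Pi.single i₀ 1 : ι → ℝ) i • A i := fun i₀ => by
    rw [Finset.sum_eq_single i₀ (fun i _ hi => by simp [Pi.single_eq_of_ne hi, hne i]) (by simp)]
    simp
  have hnonneg : ∀ i₀, (0 : ι → ℝ) ≤ Pi.single i₀ 1 := fun i₀ => Pi.single_nonneg.2 zero_le_one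
  induction S using Finset.induction_on with
  | empty => simp [hne]
  | insert j S hj ih =>
    rw [Finset.sum_insert hj, Finset.sum_insert hj, ih, hsingle (I j), ← Finset.sum_add_distrib]
    refine Finset.sum_congr rfl fun i _ => ?_
    rw [Pi.add_apply, (hA i).add_smul (hnonneg _ i)
      (Finset.sum_nonneg (fun j _ => hnonneg (I j)) i)]

variable {ι : Type*} [Fintype ι] {n : ℕ}

theorem bodyMixedVolume_comp_eq {L : ι → ConvexBody (EuclideanSpace ℝ (Fin n))}
    {c : (Fin n → ι) → ℝ}
    (h : IsVolumeExpansion volume (fun i => (L i : Set (EuclideanSpace ℝ (Fin n)))) c)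
    (I : Fin n → ι) :
    bodyMixedVolume (fun k => L (I k)) =
      (n ! : ℝ)⁻¹ * ∑ σ : Equiv.Perm (Fin n), c (I ∘ σ) := by
  classical
  rw [bodyMixedVolume, ← sum_neg_one_pow_mul_eval c I]
  refine congrArg _ (Finset.sum_congr rfl fun S _ => congrArg _ ?_)
  rw [coe_sum_convexBody, sum_comp_eq_sum_smul (fun i => (L i).convex) (fun i => (L i).nonempty)]
  exact h.of_nonneg (fun i => (L i).convex) (fun i => (L i).isCompact) (fun i => (L i).nonempty)
    fun i => Finset.sum_nonneg (N := ι → ℝ) (fun j _ => Pi.single_nonneg.2 zero_le_one) i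

/-- The polytope spanned by a non-empty finite set, as a convex body. -/
def hullBody {V : Type*} [NormedAddCommGroup V] [NormedSpace ℝ V] (s : Finset V)
    (hs : s.Nonempty) : ConvexBody V where
  carrier := convexHull ℝ (s : Set V)
  convex' := convex_convexHull ℝ _
  isCompact' := s.finite_toSet.isCompact_convexHull ℝ
  nonempty' := hs.to_set.convexHull

theorem bodyMixedVolume_hullBody_mono {U W : Fin n → Finset (EuclideanSpace ℝ (Fin n))}
    (hU : ∀ i, (U i).Nonempty) (hW : ∀ i, (W i).Nonempty) (hUW : ∀ i, U i ⊆ W i) :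
    bodyMixedVolume (fun k => hullBody (U k) (hU k)) ≤
      bodyMixedVolume (fun k => hullBody (W k) (hW k)) := by
  obtain ⟨c₀, c₁, -, hle, h₀, h₁⟩ :=
    exists_isVolumeExpansion_convexHull volume finrank_euclideanSpace_fin hUW
  have hVU := bodyMixedVolume_comp_eq (L := fun k => hullBody (U k) (hU k)) h₀ id
  have hVW := bodyMixedVolume_comp_eq (L := fun k => hullBody (W k) (hW k)) h₁ id
  simp only [id_eq] at hVU hVW
  rw [hVU, hVW]
  exact mul_le_mul_of_nonneg_left (Finset.sum_le_sum fun σ _ => hle _) (by positivity)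

theorem sum_prod_mul_sum_comp_perm (ε : ι → ℝ) (c : (Fin n → ι) → ℝ) :
    ∑ I : Fin n → ι, (∏ k, ε (I k)) * ((n ! : ℝ)⁻¹ * ∑ σ : Equiv.Perm (Fin n), c (I ∘ σ)) =
      ∑ I : Fin n → ι, (∏ k, ε (I k)) * c I := by
  have hperm : ∀ σ : Equiv.Perm (Fin n), ∑ I : Fin n → ι, (∏ k, ε (I k)) * c (I ∘ σ) =
      ∑ I : Fin n → ι, (∏ k, ε (I k)) * c I := fun σ =>
    Fintype.sum_equiv (Equiv.arrowCongr σ.symm (Equiv.refl ι)) _ _ fun I => by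
      rw [← Equiv.prod_comp σ fun k => ε (I k)]
      rfl
  simp only [mul_left_comm _ (n ! : ℝ)⁻¹, ← Finset.mul_sum _ _ (n ! : ℝ)⁻¹,
    Finset.mul_sum _ _ (∏ _, _)]
  rw [Finset.sum_comm]
  simp only [hperm, Finset.sum_const, Finset.card_univ, Fintype.card_perm, Fintype.card_fin,
    nsmul_eq_mul]
  rw [inv_mul_cancel_left₀ (by positivity)]

theorem volume_sum_smul_convexHull {U : ι → Finset (EuclideanSpace ℝ (Fin n))}
    (hU : ∀ i, (U i).Nonempty) {ε : ι → ℝ} (hε : ∀ i, 0 < ε i) :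
    volume (∑ i, ε i • convexHull ℝ (U i : Set (EuclideanSpace ℝ (Fin n)))) =
      ∑ I : Fin n → ι, ENNReal.ofReal (∏ k, ε (I k)) *
        ENNReal.ofReal (bodyMixedVolume fun k => hullBody (U (I k)) (hU (I k))) := by
  obtain ⟨c, -, hc, -, h, -⟩ := exists_isVolumeExpansion_convexHull
    (volume : Measure (EuclideanSpace ℝ (Fin n))) finrank_euclideanSpace_fin
    fun i => Finset.Subset.refl (U i)
  have hV := bodyMixedVolume_comp_eq (L := fun i => hullBody (U i) (hU i)) h
  have hfin : volume (∑ i, ε i • convexHull ℝ (U i : Set (EuclideanSpace ℝ (Fin n)))) ≠ ⊤ :=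
    (isCompact_sum_smul (fun i => (U i).finite_toSet.isCompact_convexHull ℝ) ε).measure_lt_top.ne
  rw [← ofReal_sum_mul (fun I => Finset.prod_nonneg fun k _ => (hε _).le) fun I => by
      rw [hV I]; exact mul_nonneg (by positivity) (Finset.sum_nonneg fun σ _ => hc _),
    ← ENNReal.ofReal_toReal hfin, ← measureReal_def, h ε hε]
  simp only [hV, sum_prod_mul_sum_comp_perm]

end MixedVolume

section Uniqueness

variable {n m : ℕ}

theorem sum_prod_mul_eq_of_forall_pos {ι : Type*} [Fintype ι] {c d : (Fin n → ι) → ℝ}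
    (h : ∀ ε : ι → ℝ, (∀ i, 0 < ε i) → ∑ I, (∏ k, ε (I k)) * c I = ∑ I, (∏ k, ε (I k)) * d I)
    (ε : ι → ℝ) : ∑ I, (∏ k, ε (I k)) * c I = ∑ I, (∏ k, ε (I k)) * d I := by
  let P : ((Fin n → ι) → ℝ) → MvPolynomial ι ℝ := fun c =>
    ∑ I, (∏ k, MvPolynomial.X (I k)) * MvPolynomial.C (c I)
  have heval : ∀ c ε, MvPolynomial.eval ε (P c) = ∑ I, (∏ k, ε (I k)) * c I := fun c ε => by
    simp [P]
  have hP : P c = P d := MvPolynomial.funext_set (fun _ => Set.Ioi (0 : ℝ))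
    (fun _ => Set.Ioi_infinite 0) fun ε hε => by
      simpa only [heval] using h ε fun i => hε i (Set.mem_univ i)
  rw [← heval, hP, heval]

theorem symmetric_coeff_unique {ι : Type*} [Fintype ι] {c d : (Fin n → ι) → ℝ}
    (hc : ∀ (σ : Equiv.Perm (Fin n)) (I : Fin n → ι), c (I ∘ σ) = c I)
    (hd : ∀ (σ : Equiv.Perm (Fin n)) (I : Fin n → ι), d (I ∘ σ) = d I)
    (h : ∀ ε : ι → ℝ, (∀ i, 0 < ε i) →
      ∑ I, (∏ k, ε (I k)) * c I = ∑ I, (∏ k, ε (I k)) * d I) : c = d := by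
  classical
  funext I
  have hpolar := sum_neg_one_pow_mul_eval c I
  simp only [sum_prod_mul_eq_of_forall_pos h, sum_neg_one_pow_mul_eval d I, hc, hd,
    Finset.sum_const, Finset.card_univ, Fintype.card_perm, Fintype.card_fin] at hpolar
  exact (smul_right_injective ℝ n.factorial_ne_zero hpolar).symm

theorem IsSymmExpansion.ne_top {F : (Fin m → ℝ) → ℝ≥0∞} {c : (Fin n → Fin m) → ℝ≥0∞}
    (hc : IsSymmExpansion F c) (hF : ∃ ε : Fin m → ℝ, (∀ i, 0 < ε i) ∧ F ε ≠ ⊤)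
    (I : Fin n → Fin m) : c I ≠ ⊤ := by
  obtain ⟨ε, hε, hfin⟩ := hF
  rw [hc.2 ε hε] at hfin
  have hterm := ENNReal.sum_ne_top.1 hfin I (Finset.mem_univ I)
  have hpos : ENNReal.ofReal (∏ k, ε (I k)) ≠ 0 := by simpa using Finset.prod_pos fun k _ => hε _
  exact fun htop => hterm (by rw [htop, ENNReal.mul_top hpos])

theorem IsSymmExpansion.unique {F : (Fin m → ℝ) → ℝ≥0∞} {c d : (Fin n → Fin m) → ℝ≥0∞}
    (hc : IsSymmExpansion F c) (hd : IsSymmExpansion F d)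
    (hF : ∃ ε : Fin m → ℝ, (∀ i, 0 < ε i) ∧ F ε ≠ ⊤) : c = d := by
  have hreal : (fun I => (c I).toReal) = fun I => (d I).toReal := by
    refine symmetric_coeff_unique (fun σ I => by rw [hc.1]) (fun σ I => by rw [hd.1])
      fun ε hε => ?_
    have hnonneg : ∀ I : Fin n → Fin m, 0 ≤ ∏ k, ε (I k) := fun I =>
      Finset.prod_nonneg fun k _ => (hε _).le
    rw [← toReal_sum_ofReal_mul hnonneg (hc.ne_top hF), ← hc.2 ε hε,
      ← toReal_sum_ofReal_mul hnonneg (hd.ne_top hF), ← hd.2 ε hε]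
  funext I
  exact (ENNReal.toReal_eq_toReal_iff' (hc.ne_top hF I) (hd.ne_top hF I)).1 (congrFun hreal I)

end Uniqueness

section Approximation

theorem exists_finset_subset_convexHull_of_subset_interior {V : Type*} [NormedAddCommGroup V]
    [NormedSpace ℝ V] [FiniteDimensional ℝ V] {K C : Set V} (hK : IsCompact K)
    (hKC : K ⊆ interior C) : ∃ u : Finset V, (u : Set V) ⊆ C ∧ K ⊆ convexHull ℝ (u : Set V) := by
  classical
  refine hK.induction_on (p := fun s => ∃ u : Finset V, (u : Set V) ⊆ C ∧
    s ⊆ convexHull ℝ (u : Set V)) ⟨∅, by simp, by simp⟩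
    (fun s s' hs ⟨u, hu, h⟩ => ⟨u, hu, hs.trans h⟩) ?_ fun x hx => ?_
  · rintro s s' ⟨u, hu, h⟩ ⟨u', hu', h'⟩
    exact ⟨u ∪ u', by simpa using ⟨hu, hu'⟩, Set.union_subset
      (h.trans (convexHull_mono (by simp))) (h'.trans (convexHull_mono (by simp)))⟩
  · obtain ⟨b, hb, hbC⟩ := exists_mem_interior_convexHull_affineBasis
      (isOpen_interior.mem_nhds (hKC hx))
    refine ⟨_, mem_nhdsWithin_of_mem_nhds (mem_interior_iff_mem_nhds.1 hb),
      Finset.univ.image b, ?_, by simp⟩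
    simpa using (subset_convexHull ℝ (Set.range b)).trans (hbC.trans interior_subset)

theorem exists_finset_lt_measure_convexHull {V : Type*} [NormedAddCommGroup V] [NormedSpace ℝ V]
    [FiniteDimensional ℝ V] [MeasurableSpace V] [BorelSpace V] (μ : Measure V)
    [μ.IsAddHaarMeasure] {C : Set V} (hC : Convex ℝ C) {r : ℝ≥0∞} (hr : r < μ C) :
    ∃ u : Finset V, (u : Set V) ⊆ C ∧ r < μ (convexHull ℝ (u : Set V)) := by
  rw [← measure_interior_of_null_frontier (hC.addHaar_frontier μ)] at hr
  obtain ⟨K, hKC, hK, hrK⟩ := isOpen_interior.exists_lt_isCompact hr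
  obtain ⟨u, huC, hKu⟩ := exists_finset_subset_convexHull_of_subset_interior hK hKC
  exact ⟨u, huC, hrK.trans_le (measure_mono hKu)⟩

/-- Families of non-empty finite subsets of the sets `A i`, ordered by inclusion: the index set
along which polytopes exhaust the `A i`. -/
def FinsetFamily {ι V : Type*} (A : ι → Set V) : Type _ :=
  {U : ι → Finset V // ∀ i, (U i).Nonempty ∧ (U i : Set V) ⊆ A i}

namespace FinsetFamily

section

variable {ι V : Type*} {A : ι → Set V}

instance : PartialOrder (FinsetFamily A) :=
  inferInstanceAs (PartialOrder {U : ι → Finset V // ∀ i, (U i).Nonempty ∧ (U i : Set V) ⊆ A i})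

instance : IsDirectedOrder (FinsetFamily A) where
  directed U W := by
    classical
    refine ⟨⟨fun i => U.1 i ∪ W.1 i, fun i => ⟨(U.2 i).1.mono Finset.subset_union_left, ?_⟩⟩,
      fun i => Finset.subset_union_left, fun i => Finset.subset_union_right⟩
    rw [Finset.coe_union]
    exact Set.union_subset (U.2 i).2 (W.2 i).2

theorem exists_subset (hne : ∀ i, (A i).Nonempty) {u : ι → Finset V}
    (hu : ∀ i, (u i : Set V) ⊆ A i) : ∃ U : FinsetFamily A, ∀ i, u i ⊆ U.1 i := by
  classical
  choose x hx using hne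
  exact ⟨⟨fun i => insert (x i) (u i), fun i => ⟨Finset.insert_nonempty _ _, by
    simpa [Set.insert_subset_iff] using ⟨hx i, hu i⟩⟩⟩, fun i => Finset.subset_insert _ _⟩

theorem nonempty (hne : ∀ i, (A i).Nonempty) : Nonempty (FinsetFamily A) :=
  let ⟨U, _⟩ := exists_subset hne (u := fun _ => ∅) (by simp)
  ⟨U⟩

end

variable {ι V : Type*} [NormedAddCommGroup V] [NormedSpace ℝ V] {A : ι → Set V}

/-- The polytopes spanned by a family of finite sets. -/
def hull (U : FinsetFamily A) (i : ι) : ConvexBody V :=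
  hullBody (U.1 i) (U.2 i).1

theorem hull_subset (hA : ∀ i, Convex ℝ (A i)) (U : FinsetFamily A) (i : ι) :
    (U.hull i : Set V) ⊆ A i :=
  convexHull_min (U.2 i).2 (hA i)

theorem hull_mono {U W : FinsetFamily A} (h : U ≤ W) (i : ι) : (U.hull i : Set V) ⊆ W.hull i :=
  convexHull_mono (Finset.coe_subset.2 (h i))

end FinsetFamily

section

variable {ι V : Type*} [Fintype ι] [NormedAddCommGroup V] [NormedSpace ℝ V] {A : ι → Set V}

theorem sum_smul_subset_sum_smul {B : ι → Set V} (h : ∀ i, A i ⊆ B i) (t : ι → ℝ) :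
    ∑ i, t i • A i ⊆ ∑ i, t i • B i :=
  Set.finsetSum_subset_finsetSum _ _ _ fun i _ => Set.smul_set_mono (h i)

theorem convex_sum_smul (hA : ∀ i, Convex ℝ (A i)) (t : ι → ℝ) : Convex ℝ (∑ i, t i • A i) :=
  convex_sum _ fun i _ => (hA i).smul (t i)

theorem FinsetFamily.exists_subset_sum_smul_hull (hne : ∀ i, (A i).Nonempty) {t : ι → ℝ}
    {u : Finset V} (hu : (u : Set V) ⊆ ∑ i, t i • A i) :
    ∃ U : FinsetFamily A, (u : Set V) ⊆ ∑ i, t i • (U.hull i : Set V) := by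
  classical
  have hdecomp : ∀ p : u, ∃ g : ι → V, (∀ i, g i ∈ A i) ∧ ∑ i, t i • g i = p := fun p => by
    obtain ⟨y, hy, hyp⟩ := (Set.mem_fintype_sum _ _).1 (hu p.2)
    choose g hg hgy using fun i => Set.mem_smul_set.1 (hy i)
    exact ⟨g, hg, hyp ▸ Finset.sum_congr rfl fun i _ => hgy i⟩
  choose g hgA hgp using hdecomp
  obtain ⟨U, hU⟩ := FinsetFamily.exists_subset hne (u := fun i => Finset.univ.image (g · i))
    fun i => by simpa [Set.range_subset_iff] using fun v hv => hgA ⟨v, hv⟩ i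
  refine ⟨U, fun p hp => (Set.mem_fintype_sum _ _).2 ⟨_, fun i => Set.smul_mem_smul_set
    (subset_convexHull ℝ _ (hU i (Finset.mem_image_of_mem _ (Finset.mem_univ ⟨p, hp⟩)))),
    hgp ⟨p, hp⟩⟩⟩

variable [FiniteDimensional ℝ V] [MeasurableSpace V] [BorelSpace V] (μ : Measure V)
  [μ.IsAddHaarMeasure]

theorem measure_sum_smul_eq_iSup_hull (hA : ∀ i, Convex ℝ (A i)) (hne : ∀ i, (A i).Nonempty)
    (t : ι → ℝ) :
    μ (∑ i, t i • A i) = ⨆ U : FinsetFamily A, μ (∑ i, t i • (U.hull i : Set V)) := by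
  refine le_antisymm (le_of_forall_lt fun r hr => ?_)
    (iSup_le fun U => measure_mono (sum_smul_subset_sum_smul (U.hull_subset hA) t))
  obtain ⟨u, hu, hru⟩ := exists_finset_lt_measure_convexHull μ (convex_sum_smul hA t) hr
  obtain ⟨U, hU⟩ := FinsetFamily.exists_subset_sum_smul_hull hne hu
  exact lt_iSup_iff.2 ⟨U, hru.trans_le (measure_mono (convexHull_min hU
    (convex_sum_smul (fun i => (U.hull i).convex) t)))⟩

theorem tendsto_measure_sum_smul_hull (hA : ∀ i, Convex ℝ (A i)) (hne : ∀ i, (A i).Nonempty)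
    (t : ι → ℝ) :
    Tendsto (fun U : FinsetFamily A => μ (∑ i, t i • (U.hull i : Set V))) atTop
      (𝓝 (μ (∑ i, t i • A i))) := by
  rw [measure_sum_smul_eq_iSup_hull μ hA hne]
  exact tendsto_atTop_iSup fun U W h =>
    measure_mono (sum_smul_subset_sum_smul (FinsetFamily.hull_mono h) t)

end

variable {n : ℕ}

theorem tendsto_bodyMixedVolume_hull (L : Fin n → ConvexBody (EuclideanSpace ℝ (Fin n))) :
    Tendsto (fun U : FinsetFamily fun k => (L k : Set (EuclideanSpace ℝ (Fin n))) =>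
      bodyMixedVolume U.hull) atTop (𝓝 (bodyMixedVolume L)) := by
  unfold bodyMixedVolume
  refine tendsto_const_nhds.mul (tendsto_finsetSum _ fun S _ => tendsto_const_nhds.mul ?_)
  have hsum : ∀ L : Fin n → ConvexBody (EuclideanSpace ℝ (Fin n)),
      ((∑ i ∈ S, L i : ConvexBody _) : Set (EuclideanSpace ℝ (Fin n))) =
        ∑ i, (∑ j ∈ S, (Pi.single j 1 : Fin n → ℝ)) i • (L i : Set (EuclideanSpace ℝ (Fin n))) :=
    fun L => (coe_sum_convexBody S L).trans
      (sum_comp_eq_sum_smul (fun i => (L i).convex) (fun i => (L i).nonempty) id S)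
  refine (ENNReal.tendsto_toReal (ConvexBody.isCompact _).measure_lt_top.ne).comp ?_
  simp only [hsum]
  exact tendsto_measure_sum_smul_hull volume (fun k => (L k).convex) (fun k => (L k).nonempty) _

variable {ι : Type*} {A : ι → Set (EuclideanSpace ℝ (Fin n))}

theorem iSup_bodyMixedVolume_hull (hA : ∀ i, Convex ℝ (A i)) (hne : ∀ i, (A i).Nonempty)
    (I : Fin n → ι) :
    ⨆ U : FinsetFamily A, ENNReal.ofReal (bodyMixedVolume fun k => U.hull (I k)) =
      mixedVolume fun k => A (I k) := by
  classical
  refine le_antisymm (iSup_le fun U => le_iSup₂_of_le (fun k => U.hull (I k))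
    (fun k => U.hull_subset hA (I k)) le_rfl) (iSup₂_le fun L hL => ?_)
  have := FinsetFamily.nonempty fun k => (L k).nonempty
  refine le_of_tendsto' ((ENNReal.continuous_ofReal.tendsto _).comp
    (tendsto_bodyMixedVolume_hull L)) fun W => ?_
  obtain ⟨U, hU⟩ := FinsetFamily.exists_subset hne
    (u := fun i => (Finset.univ.filter (I · = i)).biUnion W.1) fun i => by
      simp only [Finset.coe_biUnion, Set.iUnion₂_subset_iff]
      intro k hk
      obtain rfl : I k = i := by simpa using hk
      exact (W.2 k).2.trans (hL k)
  refine le_iSup_of_le U (ENNReal.ofReal_le_ofReal (bodyMixedVolume_hullBody_mono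
    (fun k => (W.2 k).1) (fun k => (U.2 (I k)).1) fun k => ?_))
  exact (Finset.subset_biUnion_of_mem W.1 (by simp)).trans (hU (I k))

theorem volume_sum_smul_eq_sum_mixedVolume [Fintype ι] (hA : ∀ i, Convex ℝ (A i))
    (hne : ∀ i, (A i).Nonempty) {ε : ι → ℝ} (hε : ∀ i, 0 < ε i) :
    volume (∑ i, ε i • A i) =
      ∑ I : Fin n → ι, ENNReal.ofReal (∏ k, ε (I k)) * mixedVolume fun k => A (I k) := by
  have hpolytope : ∀ U : FinsetFamily A,
      volume (∑ i, ε i • (U.hull i : Set (EuclideanSpace ℝ (Fin n)))) =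
        ∑ I : Fin n → ι, ENNReal.ofReal (∏ k, ε (I k)) *
          ENNReal.ofReal (bodyMixedVolume fun k => U.hull (I k)) := fun U =>
    volume_sum_smul_convexHull (fun i => (U.2 i).1) hε
  rw [measure_sum_smul_eq_iSup_hull volume hA hne]
  simp only [hpolytope, ← iSup_bodyMixedVolume_hull hA hne, ENNReal.mul_iSup]
  refine (ENNReal.finsetSum_iSup_of_monotone fun I U W h => ?_).symm
  gcongr
  exact bodyMixedVolume_hullBody_mono _ _ fun k => h (I k)

end Approximation

section LevelSets

variable {n m : ℕ}

theorem setOf_lt_oplus (f g : EuclideanSpace ℝ (Fin n) → ℝ≥0∞) (s : ℝ≥0∞) :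
    {x | s < oplus f g x} = {x | s < f x} + {x | s < g x} := by
  ext x
  simp only [oplus, Set.mem_ofPred_eq, lt_iSup_iff, lt_min_iff, Set.mem_add]
  constructor
  · rintro ⟨y, hy, hxy⟩
    exact ⟨y, hy, x - y, hxy, by abel⟩
  · rintro ⟨y, hy, z, hz, rfl⟩
    exact ⟨y, hy, by simpa using hz⟩

theorem setOf_lt_oplusSum (s : ℝ≥0∞) :
    ∀ (m : ℕ) (g : Fin (m + 1) → EuclideanSpace ℝ (Fin n) → ℝ≥0∞),
      {x | s < oplusSum m g x} = ∑ i, {x | s < g i x}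
  | 0, g => by simp [oplusSum]
  | m + 1, g => by
    rw [Fin.sum_univ_castSucc, ← setOf_lt_oplusSum s m fun i => g i.castSucc, ← setOf_lt_oplus]
    rfl

theorem setOf_lt_odot {a : ℝ} (ha : 0 < a) (f : EuclideanSpace ℝ (Fin n) → ℝ≥0∞) (s : ℝ≥0∞) :
    {x | s < odot a f x} = a • {x | s < f x} := by
  ext x
  rw [Set.mem_smul_set_iff_inv_smul_mem₀ ha.ne']
  rfl

theorem setOf_lt_oplusSum_odot {ε : Fin (m + 1) → ℝ} (hε : ∀ i, 0 < ε i)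
    (g : Fin (m + 1) → EuclideanSpace ℝ (Fin n) → ℝ≥0∞) (s : ℝ≥0∞) :
    {x | s < oplusSum m (fun i => odot (ε i) (g i)) x} = ∑ i, ε i • {x | s < g i x} := by
  rw [setOf_lt_oplusSum]
  exact Finset.sum_congr rfl fun i _ => setOf_lt_odot (hε i) _ s

theorem setOf_ofReal_lt_toENN (f : EuclideanSpace ℝ (Fin n) → ℝ) {t : ℝ} (ht : 0 ≤ t) :
    {x | ENNReal.ofReal t < toENN f x} = {x | t < f x} :=
  Set.ext fun _ => ENNReal.ofReal_lt_ofReal_iff_of_nonneg ht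

theorem setOf_lt_nonempty_iff (f : EuclideanSpace ℝ (Fin n) → ℝ) {t : ℝ} (ht : 0 ≤ t) :
    {x | t < f x}.Nonempty ↔ ENNReal.ofReal t < height f := by
  rw [← setOf_ofReal_lt_toENN f ht, height, lt_iSup_iff]
  rfl

theorem convex_setOf_lt {V β : Type*} [AddCommGroup V] [Module ℝ V] [LinearOrder β]
    {f : V → β} (hf : QuasiconcaveOn ℝ Set.univ f) (s : β) : Convex ℝ {x | s < f x} := by
  simpa using hf.convex_gt s

theorem quasiconcaveOn_toENN {f : EuclideanSpace ℝ (Fin n) → ℝ}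
    (hf : QuasiconcaveOn ℝ Set.univ f) : QuasiconcaveOn ℝ Set.univ (toENN f) :=
  hf.monotone_comp fun _ _ => ENNReal.ofReal_le_ofReal

theorem aemeasurable_of_convex_setOf_lt {V : Type*} [NormedAddCommGroup V] [NormedSpace ℝ V]
    [FiniteDimensional ℝ V] [MeasurableSpace V] [BorelSpace V] (μ : Measure V)
    [μ.IsAddHaarMeasure] {h : V → ℝ≥0∞} (hh : ∀ s, Convex ℝ {x | s < h x}) : AEMeasurable h μ := by
  have hnull : Measurable[NullMeasurableSpace.instMeasurableSpace (μ := μ)] h :=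
    measurable_of_Ioi fun s => (hh s).nullMeasurableSet μ
  exact NullMeasurable.aemeasurable hnull

theorem lintegral_eq_lintegral_measure_ofReal_lt {α : Type*} [MeasurableSpace α] (μ : Measure α)
    {h : α → ℝ≥0∞} (hh : AEMeasurable h μ) :
    ∫⁻ x, h x ∂μ = ∫⁻ t in Set.Ioi (0 : ℝ), μ {x | ENNReal.ofReal t < h x} := by
  by_cases htop : μ {x | h x = ⊤} = 0
  · have hae : ∀ᵐ x ∂μ, h x ≠ ⊤ := by simpa [ae_iff] using htop
    calc ∫⁻ x, h x ∂μ = ∫⁻ x, ENNReal.ofReal (h x).toReal ∂μ :=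
          lintegral_congr_ae (hae.mono fun x hx => (ENNReal.ofReal_toReal hx).symm)
      _ = ∫⁻ t in Set.Ioi (0 : ℝ), μ {x | t < (h x).toReal} :=
          lintegral_eq_lintegral_meas_lt μ (.of_forall fun x => ENNReal.toReal_nonneg)
            hh.ennreal_toReal
      _ = ∫⁻ t in Set.Ioi (0 : ℝ), μ {x | ENNReal.ofReal t < h x} :=
          setLIntegral_congr_fun measurableSet_Ioi fun t ht => measure_congr <| hae.mono fun x hx =>
            propext (ENNReal.ofReal_lt_iff_lt_toReal (le_of_lt ht) hx).symm
  · rw [lintegral_eq_top_of_measure_eq_top_ne_zero hh htop, eq_comm, eq_top_iff]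
    calc ⊤ = ∫⁻ _ in Set.Ioi (0 : ℝ), μ {x | h x = ⊤} := by
          rw [setLIntegral_const, Real.volume_Ioi, ENNReal.mul_top htop]
      _ ≤ ∫⁻ t in Set.Ioi (0 : ℝ), μ {x | ENNReal.ofReal t < h x} :=
          lintegral_mono fun t => measure_mono fun x (hx : h x = ⊤) => by simp [hx]

theorem measurableSet_levels (T : ℝ≥0∞) : MeasurableSet {t : ℝ | 0 < t ∧ ENNReal.ofReal t < T} :=
  measurableSet_Ioi.inter (measurableSet_lt ENNReal.measurable_ofReal measurable_const)

theorem lintegral_Ioi_eq_lintegral_levels {T : ℝ≥0∞} {g : ℝ → ℝ≥0∞}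
    (hg : ∀ t, 0 < t → T < ENNReal.ofReal t → g t = 0) :
    ∫⁻ t in Set.Ioi 0, g t = ∫⁻ t in {t : ℝ | 0 < t ∧ ENNReal.ofReal t < T}, g t := by
  rw [← lintegral_indicator measurableSet_Ioi, ← lintegral_indicator (measurableSet_levels T)]
  refine lintegral_congr_ae ?_
  filter_upwards [Measure.ae_ne volume T.toReal] with t hne
  by_cases ht : 0 < t
  swap
  · rw [Set.indicator_of_notMem (by simpa using ht), Set.indicator_of_notMem fun h => ht h.1]
  rw [Set.indicator_of_mem (Set.mem_Ioi.2 ht)]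
  rcases lt_trichotomy (ENNReal.ofReal t) T with hlt | heq | hgt
  · have hmem : t ∈ {t : ℝ | 0 < t ∧ ENNReal.ofReal t < T} := ⟨ht, hlt⟩
    rw [Set.indicator_of_mem hmem]
  · exact absurd (by rw [← heq, ENNReal.toReal_ofReal ht.le]) hne
  · rw [Set.indicator_of_notMem fun h => hgt.not_gt h.2, hg t ht hgt]

end LevelSets

section MixedIntegral

variable {n m : ℕ}

theorem mixedVolume_mono {K K' : Fin n → Set (EuclideanSpace ℝ (Fin n))} (h : ∀ k, K k ⊆ K' k) :
    mixedVolume K ≤ mixedVolume K' :=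
  iSup₂_le fun L hL => le_iSup₂_of_le L (fun k => (hL k).trans (h k)) le_rfl

theorem mixedVolume_eq_zero {K : Fin n → Set (EuclideanSpace ℝ (Fin n))} {k : Fin n}
    (hk : K k = ∅) : mixedVolume K = 0 :=
  le_bot_iff.1 <| iSup₂_le fun L hL => absurd ((L k).nonempty.mono (hL k)) (by simp [hk])

theorem bodyMixedVolume_comp_perm (L : Fin n → ConvexBody (EuclideanSpace ℝ (Fin n)))
    (σ : Equiv.Perm (Fin n)) : bodyMixedVolume (L ∘ σ) = bodyMixedVolume L := by
  unfold bodyMixedVolume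
  congr 1
  exact Fintype.sum_equiv σ.finsetCongr _ _ fun S => by simp [Equiv.finsetCongr_apply]

theorem mixedVolume_comp_perm (K : Fin n → Set (EuclideanSpace ℝ (Fin n)))
    (σ : Equiv.Perm (Fin n)) : mixedVolume (K ∘ σ) = mixedVolume K := by
  have hle : ∀ (K : Fin n → Set (EuclideanSpace ℝ (Fin n))) (σ : Equiv.Perm (Fin n)),
      mixedVolume K ≤ mixedVolume (K ∘ σ) := fun K σ =>
    iSup₂_le fun L hL => le_iSup₂_of_le (L ∘ σ) (fun k => hL (σ k))
      (by rw [bodyMixedVolume_comp_perm])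
  refine le_antisymm ?_ (hle K σ)
  simpa [Function.comp_assoc] using hle (K ∘ σ) σ⁻¹

theorem antitone_mixedVolume_levelSet (g : Fin n → EuclideanSpace ℝ (Fin n) → ℝ) :
    Antitone fun t => mixedVolume fun k => levelSet (g k) t :=
  fun _ _ h => mixedVolume_mono fun _ _ hx => h.trans hx

theorem antitone_mixedVolume_setOf_lt (g : Fin n → EuclideanSpace ℝ (Fin n) → ℝ) :
    Antitone fun t => mixedVolume fun k => {x | t < g k x} :=
  fun _ _ h => mixedVolume_mono fun _ _ hx => h.trans_lt hx

theorem mixedVolume_setOf_lt_ae_eq (g : Fin n → EuclideanSpace ℝ (Fin n) → ℝ) :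
    (fun t => mixedVolume fun k => {x | t < g k x}) =ᵐ[volume]
      fun t => mixedVolume fun k => levelSet (g k) t := by
  filter_upwards [(antitone_mixedVolume_levelSet g).countable_not_continuousAt.ae_notMem volume]
    with t ht
  have hcont : ContinuousAt (fun t => mixedVolume fun k => levelSet (g k) t) t := by
    simpa using ht
  refine le_antisymm (mixedVolume_mono fun k x (hx : t < g k x) => hx.le)
    (le_of_tendsto (hcont.tendsto.mono_left (nhdsWithin_le_nhds (s := Set.Ioi t))) ?_)
  filter_upwards [eventually_mem_nhdsWithin] with s (hs : t < s)
  exact mixedVolume_mono fun k x (hx : s ≤ g k x) => hs.trans_le hx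

variable {f : Fin (m + 1) → EuclideanSpace ℝ (Fin n) → ℝ} {ε : Fin (m + 1) → ℝ} {t : ℝ}

theorem aemeasurable_oplusSum_odot (hf : ∀ i, QuasiconcaveOn ℝ Set.univ (f i))
    (hε : ∀ i, 0 < ε i) : AEMeasurable (oplusSum m fun i => odot (ε i) (toENN (f i))) :=
  aemeasurable_of_convex_setOf_lt volume fun s => by
    rw [setOf_lt_oplusSum_odot hε]
    exact convex_sum_smul (fun i => convex_setOf_lt (quasiconcaveOn_toENN (hf i)) s) ε

theorem volume_setOf_lt_oplusSum_odot (hf : ∀ i, QuasiconcaveOn ℝ Set.univ (f i))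
    (hε : ∀ i, 0 < ε i) (ht : 0 ≤ t) (htop : ENNReal.ofReal t < ⨅ j, height (f j)) :
    volume {x | ENNReal.ofReal t < oplusSum m (fun i => odot (ε i) (toENN (f i))) x} =
      ∑ I : Fin n → Fin (m + 1), ENNReal.ofReal (∏ k, ε (I k)) *
        mixedVolume fun k => {x | t < f (I k) x} := by
  simp only [setOf_lt_oplusSum_odot hε, setOf_ofReal_lt_toENN _ ht]
  exact volume_sum_smul_eq_sum_mixedVolume (fun i => convex_setOf_lt (hf i) t)
    (fun i => (setOf_lt_nonempty_iff _ ht).2 (htop.trans_le (iInf_le _ i))) hε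

theorem setOf_lt_oplusSum_odot_eq_empty (hε : ∀ i, 0 < ε i) (ht : 0 ≤ t)
    (htop : ⨅ j, height (f j) ≤ ENNReal.ofReal t) :
    {x | ENNReal.ofReal t < oplusSum m (fun i => odot (ε i) (toENN (f i))) x} = ∅ := by
  obtain ⟨j, hj⟩ := exists_eq_ciInf_of_finite (f := fun j => height (f j))
  have hempty : {x | t < f j x} = ∅ := by
    rw [← Set.not_nonempty_iff_eq_empty, setOf_lt_nonempty_iff _ ht, not_lt]
    exact hj.trans_le htop
  simp only [setOf_lt_oplusSum_odot hε, setOf_ofReal_lt_toENN _ ht]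
  refine Set.eq_empty_of_forall_notMem fun x hx => ?_
  obtain ⟨y, hy, -⟩ := (Set.mem_fintype_sum _ _).1 hx
  simpa [hempty] using hy j

theorem sumIntegral_eq_sum_mixedIntegralUpTo (hf : ∀ i, QuasiconcaveOn ℝ Set.univ (f i))
    (hε : ∀ i, 0 < ε i) :
    sumIntegral f ε = ∑ I : Fin n → Fin (m + 1), ENNReal.ofReal (∏ k, ε (I k)) *
      mixedIntegralUpTo (⨅ j, height (f j)) fun k => f (I k) := by
  have hmeas : ∀ I : Fin n → Fin (m + 1),
      Measurable fun t => mixedVolume fun k => {x | t < f (I k) x} := fun I =>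
    (antitone_mixedVolume_setOf_lt fun k => f (I k)).measurable
  rw [sumIntegral,
    lintegral_eq_lintegral_measure_ofReal_lt volume (aemeasurable_oplusSum_odot hf hε),
    lintegral_Ioi_eq_lintegral_levels fun t ht hgt => by
      rw [setOf_lt_oplusSum_odot_eq_empty hε ht.le hgt.le, measure_empty],
    setLIntegral_congr_fun (measurableSet_levels _) fun t ht =>
      volume_setOf_lt_oplusSum_odot hf hε ht.1.le ht.2,
    lintegral_finsetSum _ fun I _ => (hmeas I).const_mul _]
  refine Finset.sum_congr rfl fun I _ => ?_
  rw [lintegral_const_mul _ (hmeas I), mixedIntegralUpTo]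
  exact congrArg _ (lintegral_congr_ae
    (ae_restrict_of_ae (mixedVolume_setOf_lt_ae_eq fun k => f (I k))))

theorem isSymmExpansion_sumIntegral (hf : ∀ i, QuasiconcaveOn ℝ Set.univ (f i)) :
    IsSymmExpansion (sumIntegral f) fun I : Fin n → Fin (m + 1) =>
      mixedIntegralUpTo (⨅ j, height (f j)) fun k => f (I k) :=
  ⟨fun σ I => lintegral_congr fun t => mixedVolume_comp_perm (fun k => levelSet (f (I k)) t) σ,
    fun _ hε => sumIntegral_eq_sum_mixedIntegralUpTo hf hε⟩

theorem mixedIntegralUpTo_eq_mixedIntegral {g : Fin n → EuclideanSpace ℝ (Fin n) → ℝ} {T : ℝ≥0∞}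
    {k : Fin n} (hk : height (g k) ≤ T) : mixedIntegralUpTo T g = mixedIntegral g := by
  refine (lintegral_Ioi_eq_lintegral_levels fun t _ htT => mixedVolume_eq_zero (k := k) ?_).symm
  refine Set.eq_empty_of_forall_notMem fun x (hx : t ≤ g k x) => htT.not_ge ?_
  exact (ENNReal.ofReal_le_ofReal hx).trans ((le_iSup (toENN (g k)) x).trans hk)

end MixedIntegral

end QuasiConcave

end

theorem mainTheorem1_general {n m : ℕ} (f : Fin (m + 1) → EuclideanSpace ℝ (Fin n) → ℝ)
    (hf : ∀ i, 0 ≤ f i ∧ QuasiconcaveOn ℝ Set.univ (f i)) :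
    QuasiConcave.IsSymmExpansion (QuasiConcave.sumIntegral f)
      (fun I : Fin n → Fin (m + 1) =>
        QuasiConcave.mixedIntegralUpTo (⨅ j, QuasiConcave.height (f j)) fun k => f (I k)) ∧
    (∀ c : (Fin n → Fin (m + 1)) → ENNReal,
      QuasiConcave.IsSymmExpansion (QuasiConcave.sumIntegral f) c →
      (∃ ε : Fin (m + 1) → ℝ, (∀ i, 0 < ε i) ∧ QuasiConcave.sumIntegral f ε ≠ ⊤) →
      ∀ I : Fin n → Fin (m + 1), c I =
        QuasiConcave.mixedIntegralUpTo (⨅ j, QuasiConcave.height (f j)) fun k => f (I k)) ∧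
    (∀ I : Fin n → Fin (m + 1), Function.Surjective I →
      QuasiConcave.mixedIntegralUpTo (⨅ j, QuasiConcave.height (f j)) (fun k => f (I k)) =
        QuasiConcave.mixedIntegral fun k => f (I k)) ∧
    (∀ I : Fin n → Fin (m + 1),
      (∃ k, ∀ j, QuasiConcave.height (f (I k)) ≤ QuasiConcave.height (f j)) →
      QuasiConcave.mixedIntegralUpTo (⨅ j, QuasiConcave.height (f j)) (fun k => f (I k)) =
        QuasiConcave.mixedIntegral fun k => f (I k)) := by
  have hexp := QuasiConcave.isSymmExpansion_sumIntegral (n := n) fun i => (hf i).2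
  refine ⟨hexp, fun c hc hfin I => congrFun (hc.unique hexp hfin) I, fun I hI => ?_,
    fun I ⟨k, hk⟩ => ?_⟩
  · obtain ⟨j, hj⟩ := exists_eq_ciInf_of_finite (f := fun j => QuasiConcave.height (f j))
    obtain ⟨k, rfl⟩ := hI j
    exact QuasiConcave.mixedIntegralUpTo_eq_mixedIntegral (k := k) hj.le
  · exact QuasiConcave.mixedIntegralUpTo_eq_mixedIntegral (k := k) (le_iInf hk)

theorem mainTheorem1 {n m : ℕ} (f : Fin (m + 1) → EuclideanSpace ℝ (Fin n) → ℝ)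
    (hf : ∀ i, QuasiConcave.IsQC (f i)) :
    -- `F` is a homogeneous polynomial of degree `n` with symmetric coefficients in `[0, ∞]`,
    -- given by integrals of mixed volumes up to the smallest of the suprema of the functions
    QuasiConcave.IsSymmExpansion (QuasiConcave.sumIntegral f)
      (fun I : Fin n → Fin (m + 1) =>
        QuasiConcave.mixedIntegralUpTo (⨅ j, QuasiConcave.height (f j)) fun k => f (I k)) ∧
    -- if `F` is finite somewhere, these are the only symmetric coefficients
    (∀ c : (Fin n → Fin (m + 1)) → ENNReal,
      QuasiConcave.IsSymmExpansion (QuasiConcave.sumIntegral f) c →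
      (∃ ε : Fin (m + 1) → ℝ, (∀ i, 0 < ε i) ∧ QuasiConcave.sumIntegral f ε ≠ ⊤) →
      ∀ I : Fin n → Fin (m + 1), c I =
        QuasiConcave.mixedIntegralUpTo (⨅ j, QuasiConcave.height (f j)) fun k => f (I k)) ∧
    -- a coefficient that involves all the functions is the full mixed integral
    (∀ I : Fin n → Fin (m + 1), Function.Surjective I →
      QuasiConcave.mixedIntegralUpTo (⨅ j, QuasiConcave.height (f j)) (fun k => f (I k)) =
        QuasiConcave.mixedIntegral fun k => f (I k)) ∧
    -- and so is every coefficient that involves a function of smallest supremum; in particular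
    -- every coefficient, if `n ≥ 1` and all the functions have the same supremum
    (∀ I : Fin n → Fin (m + 1),
      (∃ k, ∀ j, QuasiConcave.height (f (I k)) ≤ QuasiConcave.height (f j)) →
      QuasiConcave.mixedIntegralUpTo (⨅ j, QuasiConcave.height (f j)) (fun k => f (I k)) =
        QuasiConcave.mixedIntegral fun k => f (I k)) :=
  mainTheorem1_general f fun i => ⟨(hf i).nonneg, (hf i).quasiconcave⟩
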